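/- Let $k$ be a field of characteristic $0$ and $n\in\mathbb Z$. A finite-dimensional formal moduli problem $X$ is given by a finite-dimensional $L_\infty$ algebra $\mathfrak g$ over $k$, that is, by a degree $1$ formal vector field $Q_{\mathfrak g}$ on $\mathfrak g[1]$ vanishing at $0$ with $[Q_{\mathfrak g},Q_{\mathfrak g}]=0$. A strict constant-coefficient $n$-shifted symplectic structure on $X$ is a graded antisymmetric nondegenerate pairing $\omega$ of degree $-n$ on $\mathfrak g[1]$ (equivalently, a symmetric isomorphism $\mathfrak g\to\mathfrak g^*[n-2]$) such that $\mathcal L_{Q_{\mathfrak g}}\omega=0$. A regular embedded Lagrangian $L_+\hookrightarrow X$ is an injective strict $L_\infty$ map $f:\mathfrak l_+\to\mathfrak g$ from a finite-dimensional $L_\infty$ algebra with $f(\mathfrak l_+)=f(\mathfrak l_+)^{\perp_\omega}$. Polyvector fields $\Gamma(L_+,\widehat{\mathrm{Sym}}^\bullet(\mathbb T_{L_+}[-n]))$ are identified with formal functions on $\mathfrak l_+[1]\oplus(\mathfrak l_+[1])^*[n]$, with $\mathrm{Sym}^j$ corresponding to degree $j$ in the fibre $(\mathfrak l_+[1])^*[n]$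 and the Schouten bracket $[\cdot,\cdot]$ to the Poisson bracket of the canonical $n$-shifted symplectic form $\omega_{\mathrm{can}}$. An $(n-1)$-shifted homotopy Poisson structure on $L_+$ is $\bar\Pi=(\Pi_j)_{j\ge 2}$ with $\Pi_j\in\Gamma(L_+,\mathrm{Sym}^j(\mathbb T_{L_+}[-n]))$ of cohomological degree $n+1$ and $[Q_{\mathfrak l_+}+\bar\Pi,\,Q_{\mathfrak l_+}+\bar\Pi]=0$. For $\bar\Pi$ a polyvector field of this kind (with components $j\ge2$, of degree $n+1$), $T^*_{\bar\Pi}[n]L_+$ denotes $\mathfrak l_+[1]\oplus(\mathfrak l_+[1])^*[n]$ with the Hamiltonian vector field of $Q_{\mathfrak l_+}+\bar\Pi$; $T^*[n]L_+$ is the case $\bar\Pi=0$. A symplectic splitting is a degree-preserving linear isomorphism $\Phi:\mathfrak l_+[1]\oplus(\mathfrak l_+[1])^*[n]\to\mathfrak g[1]$ with $\Phi|_{\mathfrak l_+[1]}=f$ and $\Phi^*\omega=\omega_{\mathrm{can}}$. **Proposition.** Let $(X,\omega)$ be a finite-dimensional formal moduli problem with a strict constant-coefficient $n$-shifted symplectic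 structure and $L_+\hookrightarrow X$ a regular embedded Lagrangian. Then: 1. The map $w\mapsto\omega(w,f(-))$ from $f^*\mathbb T_X$ to $\mathbb L_{L_+}[n]$ is a surjective map of vector bundles on $L_+$ with kernel $\mathbb T_{L_+}$; thus the total space of the normal bundle of $L_+$ in $X$ is $T^*[n]L_+$. 2. Graded isotropic complements $\mathfrak l_-$ of $f(\mathfrak l_+)$ in $\mathfrak g$ exist, and each determines a unique symplectic splitting $\Phi$ with $\Phi((\mathfrak l_+[1])^*[n])\subseteq\mathfrak l_-[1]$. 3. For each symplectic splitting $\Phi$ there is a unique polyvector field $\bar\Pi=(\Pi_j)_{j\ge2}$ of cohomological degree $n+1$ such that $\Phi$ is a strict isomorphism $T^*_{\bar\Pi}[n]L_+\cong X$, and $\bar\Pi$ is an $(n-1)$-shifted homotopy Poisson structure on $L_+$. 4. $\bar\Pi$ is given by the deformation to the normal cone $T^*[n]L_+\rightsquigarrow X$: for every $c\in k$ the polyvector field $\bar\Pi^{(c)}=\sum_{j\ge2}c^{j-1}\Pi_j$ is an $(n-1)$-shifted homotopy Poisson structure, with $\bar\Pi^{(0)}=0$, $\bar\Pi^{(1)}=\bar\Pi$,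 and for $c\ne0$ the map $\Phi\circ(\mathrm{id}\oplus c\cdot\mathrm{id})$ is a strict isomorphism $T^*_{\bar\Pi^{(c)}}[n]L_+\cong X$. 5. $\bar\Pi$ is natural: if $\bar\Pi,\bar\Pi'$ arise from two symplectic splittings, there is a polyvector field $B$ of cohomological degree $n$ with components in $\mathrm{Sym}^j(\mathbb T_{L_+}[-n])$, $j\ge2$, such that $Q_{\mathfrak l_+}+\bar\Pi'=e^{[B,\cdot]}(Q_{\mathfrak l_+}+\bar\Pi)$; and strict isomorphisms $\psi:X\to X'$, $\chi:L_+\to L_+'$ with $\psi^*\omega'=\omega$ and $\psi f=f'\chi$ carry the structure $\bar\Pi$ of a splitting $\Phi$ to the structure $\chi_*\bar\Pi$ of the transported splitting. -/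

import Mathlib

universe u v

namespace FormalModuli

noncomputable section

/-! ### Graded vector spaces -/

/-- A `ℤ`-grading of a `k`-vector space. -/
structure Grading (k : Type*) [Field k] (V : Type*) [AddCommGroup V] [Module k V] where
  deg : ℤ → Submodule k V
  internal : DirectSum.IsInternal deg

namespace Grading

variable {k : Type*} [Field k] {V : Type*} [AddCommGroup V] [Module k V]

/-- The direct sum decomposition of `V`. -/
def decomp (𝒱 : Grading k V) : DirectSum ℤ (fun i => 𝒱.deg i) ≃ₗ[k] V :=
  LinearEquiv.ofBijective (DirectSum.coeLinearMap 𝒱.deg) 𝒱.internal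

theorem decomp_lof (𝒱 : Grading k V) (i : ℤ) (x : 𝒱.deg i) :
    𝒱.decomp (DirectSum.lof k ℤ (fun i => 𝒱.deg i) i x) = x :=
  DirectSum.coeLinearMap_lof 𝒱.deg i x

/-- The operator that multiplies the degree `i` component by `c i`. -/
def act (𝒱 : Grading k V) (c : ℤ → k) : V →ₗ[k] V :=
  𝒱.decomp.toLinearMap ∘ₗ
    DirectSum.lmap (fun i => c i • (LinearMap.id : 𝒱.deg i →ₗ[k] 𝒱.deg i)) ∘ₗ
      𝒱.decomp.symm.toLinearMap

theorem act_of_mem (𝒱 : Grading k V) (c : ℤ → k) {i : ℤ} {x : V} (hx : x ∈ 𝒱.deg i) :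
    𝒱.act c x = c i • x := by
  have h : 𝒱.decomp.symm x = DirectSum.lof k ℤ (fun i => 𝒱.deg i) i ⟨x, hx⟩ := by
    rw [LinearEquiv.symm_apply_eq, decomp_lof]
  simp only [act, LinearMap.comp_apply, LinearEquiv.coe_coe, h, DirectSum.lmap_lof, decomp_lof]
  simp

/-- Projection to the odd part (`b = true`) or to the even part (`b = false`). -/
def parityProj (𝒱 : Grading k V) (b : Bool) : V →ₗ[k] V :=
  𝒱.act fun i => if decide (Odd i) = b then 1 else 0

/-- The operator `x ↦ (-1) ^ (e * |x|) x`. -/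
def signOp (𝒱 : Grading k V) (e : ℤ) : V →ₗ[k] V :=
  𝒱.act fun i => ((((e * i).negOnePow : ℤˣ) : ℤ) : k)

theorem signOp_signOp (𝒱 : Grading k V) (e : ℤ) (x : V) :
    𝒱.signOp e (𝒱.signOp e x) = x := by
  have hx : x ∈ ⨆ i, 𝒱.deg i := by
    rw [𝒱.internal.submodule_iSup_eq_top]; trivial
  induction hx using Submodule.iSup_induction' with
  | mem i x hx =>
    simp only [signOp, 𝒱.act_of_mem _ hx, map_smul, smul_smul, ← Int.cast_mul, ← Units.val_mul,
      Int.units_mul_self]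
    simp
  | zero => simp
  | add x y _ _ h₁ h₂ => simp [h₁, h₂]

/-- The grading of `V^*[n]`: the degree `i` part consists of the functionals supported on the
component of `V` of degree `-i-n`. -/
def dualDeg (𝒱 : Grading k V) (n i : ℤ) : Submodule k (Module.Dual k V) where
  carrier := {ξ | ∀ j, j ≠ -i - n → ∀ x ∈ 𝒱.deg j, ξ x = 0}
  add_mem' := fun h₁ h₂ j hj x hx => by simp [h₁ j hj x hx, h₂ j hj x hx]
  zero_mem' := fun _ _ _ _ => rfl
  smul_mem' := fun c ξ h j hj x hx => by simp [h j hj x hx]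

/-- The graded vector space `V ⊕ V^*[n]`. -/
def cotangent [FiniteDimensional k V] (𝒱 : Grading k V) (n : ℤ) :
    Grading k (V × Module.Dual k V) where
  deg i := (𝒱.deg i).prod (𝒱.dualDeg n i)
  internal := by
    classical
    rw [DirectSum.isInternal_submodule_iff_iSupIndep_and_iSup_eq_top]
    let c : ℤ → ℤ → k := fun i j => if j = i then 1 else 0
    have hspan : ∀ x : V, x ∈ ⨆ i, 𝒱.deg i := fun x => by
      rw [𝒱.internal.submodule_iSup_eq_top]; trivial
    constructor
    · let P : ℤ → (V × Module.Dual k V) →ₗ[k] (V × Module.Dual k V) := fun i =>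
        (𝒱.act (c i)).prodMap (𝒱.act (c (-i - n))).dualMap
      have hP1 : ∀ i e, e ∈ (𝒱.deg i).prod (𝒱.dualDeg n i) → P i e = e := by
        rintro i ⟨x, ξ⟩ ⟨hx, hξ⟩
        refine Prod.ext ?_ ?_
        · simp [P, 𝒱.act_of_mem _ hx, c]
        · refine LinearMap.ext fun y => ?_
          have hy := hspan y
          change ξ (𝒱.act (c (-i - n)) y) = ξ y
          induction hy using Submodule.iSup_induction' with
          | mem j y hy =>
            rw [𝒱.act_of_mem _ hy]
            by_cases hj : j = -i - n
            · simp [c, hj]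
            · simp [c, hj, hξ j hj y hy]
          | zero => simp
          | add y z _ _ h₁ h₂ => simp [h₁, h₂]
      have hP0 : ∀ i j, j ≠ i → (𝒱.deg j).prod (𝒱.dualDeg n j) ≤ LinearMap.ker (P i) := by
        rintro i j hij ⟨x, ξ⟩ ⟨hx, hξ⟩
        rw [LinearMap.mem_ker]
        refine Prod.ext ?_ ?_
        · simp [P, 𝒱.act_of_mem _ hx, c, hij]
        · refine LinearMap.ext fun y => ?_
          have hy := hspan y
          change ξ (𝒱.act (c (-i - n)) y) = 0
          induction hy using Submodule.iSup_induction' with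
          | mem l y hy =>
            rw [𝒱.act_of_mem _ hy]
            by_cases hl : l = -i - n
            · simp [hξ l (by omega) y hy]
            · simp [c, hl]
          | zero => simp
          | add y z _ _ h₁ h₂ => simp [h₁, h₂]
      intro i
      rw [Submodule.disjoint_def]
      intro e he he'
      have h0 : P i e = 0 := LinearMap.mem_ker.1
        ((iSup₂_le fun j hj => hP0 i j hj : _ ≤ LinearMap.ker (P i)) he')
      rw [← hP1 i e he, h0]
    · rw [eq_top_iff]
      rintro ⟨x, ξ⟩ -
      have hx : ((x, 0) : V × Module.Dual k V) ∈
          ⨆ i, (𝒱.deg i).prod (𝒱.dualDeg n i) := by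
        have hx := hspan x
        induction hx using Submodule.iSup_induction' with
        | mem i x hx => exact Submodule.mem_iSup_of_mem i ⟨hx, Submodule.zero_mem _⟩
        | zero => exact Submodule.zero_mem _
        | add x y _ _ h₁ h₂ => simpa using Submodule.add_mem _ h₁ h₂
      have hξ : ((0, ξ) : V × Module.Dual k V) ∈
          ⨆ i, (𝒱.deg i).prod (𝒱.dualDeg n i) := by
        have hfin : {i | 𝒱.deg i ≠ ⊥}.Finite :=
          WellFoundedGT.finite_ne_bot_of_iSupIndep 𝒱.internal.submodule_iSupIndep
        have hsum : ((0, ξ) : V × Module.Dual k V) =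
            ∑ i ∈ hfin.toFinset, (0, ξ ∘ₗ 𝒱.act (c i)) := by
          refine Prod.ext (by simp [Prod.fst_sum]) (LinearMap.ext fun y => ?_)
          simp only [Prod.snd_sum, LinearMap.sum_apply, LinearMap.comp_apply]
          have hy := hspan y
          induction hy using Submodule.iSup_induction' with
          | mem j y hy =>
            simp only [𝒱.act_of_mem _ hy, map_smul, c]
            by_cases hj : 𝒱.deg j = ⊥
            · rw [hj, Submodule.mem_bot] at hy
              simp [hy]
            · rw [Finset.sum_eq_single j]
              · simp
              · intro b _ hb
                simp [Ne.symm hb]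
              · intro h
                exact absurd (hfin.mem_toFinset.2 hj) h
          | zero => simp
          | add y z _ _ h₁ h₂ => simp only [map_add, h₁, h₂, Finset.sum_add_distrib]
        rw [hsum]
        refine Submodule.sum_mem _ fun i _ => Submodule.mem_iSup_of_mem (-i - n) ?_
        refine ⟨Submodule.zero_mem _, fun j hj y hy => ?_⟩
        have : j ≠ i := by omega
        simp [𝒱.act_of_mem _ hy, c, this]
      simpa using Submodule.add_mem _ hx hξ

end Grading

/-! ### Formal functions and formal vector fields -/

/-- Formal maps `V → W` in Taylor coefficients: `φ` stands for the formal power series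
`∑ₘ φ m (x, …, x) / m!`.  Subject to graded symmetry, for `V` finite dimensional and `k` of
characteristic zero, these are the elements of `Sym^(V^*) ⊗ W`; the case `W = k` gives formal
functions, the case `W = V` formal vector fields. -/
abbrev FormalMap (k : Type*) [Field k] (V W : Type*) [AddCommGroup V] [Module k V]
    [AddCommGroup W] [Module k W] : Type _ :=
  ∀ m : ℕ, MultilinearMap k (fun _ : Fin m => V) W

section FormalMaps

variable {k : Type*} [Field k] {V : Type*} [AddCommGroup V] [Module k V]
  {W : Type*} [AddCommGroup W] [Module k W]

/-- Graded symmetry: exchanging two neighbouring homogeneous arguments of degrees `a`, `b`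
produces the sign `(-1) ^ (a * b)`. -/
def GradedSymm (𝒱 : Grading k V) (φ : FormalMap k V W) : Prop :=
  ∀ (m : ℕ) (v : Fin m → V) (i j : Fin m), (j : ℕ) = i + 1 →
    ∀ a b : ℤ, v i ∈ 𝒱.deg a → v j ∈ 𝒱.deg b →
      φ m (v ∘ Equiv.swap i j) = (a * b).negOnePow • φ m v

/-- A formal function is homogeneous of cohomological degree `d`. -/
def FunctionDegree (𝒱 : Grading k V) (d : ℤ) (φ : FormalMap k V k) : Prop :=
  ∀ (m : ℕ) (v : Fin m → V) (a : Fin m → ℤ), (∀ i, v i ∈ 𝒱.deg (a i)) →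
    d + ∑ i, a i ≠ 0 → φ m v = 0

/-- A formal vector field is homogeneous of cohomological degree `d`. -/
def FieldDegree (𝒱 : Grading k V) (d : ℤ) (Q : FormalMap k V V) : Prop :=
  ∀ (m : ℕ) (v : Fin m → V) (a : Fin m → ℤ), (∀ i, v i ∈ 𝒱.deg (a i)) →
    Q m v ∈ 𝒱.deg (d + ∑ i, a i)

/-- The Koszul sign of the unshuffle that moves the arguments indexed by `s` in front of the
others, when `p i` says whether the `i`-th argument is odd. -/
def koszulSign {m : ℕ} (s : Finset (Fin m)) (p : Fin m → Bool) : ℤ :=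
  ∏ x ∈ (sᶜ ×ˢ s).filter (fun x => x.1 < x.2), if p x.1 && p x.2 then -1 else 1

/-- The multilinear map `v ↦ φ (X (v_s), v_{sᶜ})`, where `v_s` lists the arguments indexed by
`s` in increasing order. -/
def insertOne (φ : FormalMap k V W) (X : FormalMap k V V) {m : ℕ} (s : Finset (Fin m)) :
    MultilinearMap k (fun _ : Fin m => V) W :=
  (MultilinearMap.curryFinFinset k W V (s := s) rfl rfl).symm
    ((φ (sᶜ.card + 1)).curryLeft.compMultilinearMap (X s.card))

/-- The derivative of `φ` along the vector field `X`: on homogeneous arguments it is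
`v ↦ ∑ₛ ± φ (X (v_s), v_{sᶜ})`, the sum over all subsets `s` with Koszul signs.  It is extended
to all arguments by splitting each of them in its even and its odd part. -/
def derivAlong (𝒱 : Grading k V) (X : FormalMap k V V) (φ : FormalMap k V W) :
    FormalMap k V W := fun m =>
  ∑ p : Fin m → Bool, ∑ s : Finset (Fin m),
    koszulSign s p • (insertOne φ X s).compLinearMap fun i => 𝒱.parityProj (p i)

/-- A bilinear form as a formal map concentrated in polynomial degree two. -/
def ofBilin (B : V →ₗ[k] V →ₗ[k] k) : FormalMap k V k
  | 2 => (MultilinearMap.ofSubsingleton k V (V →ₗ[k] k) (0 : Fin 1) B).uncurryRight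
  | _ => 0

/-- The Taylor coefficients `(v₁, …, vₘ, u) ↦ ω (Q (v₁, …, vₘ), u)`. -/
def lower (ω : V →ₗ[k] V →ₗ[k] k) (Q : FormalMap k V V) : FormalMap k V k
  | 0 => 0
  | m + 1 => (ω.compMultilinearMap (Q m)).uncurryRight

/-- A degree-preserving linear map that intertwines all Taylor coefficients of two vector
fields; for cohomological vector fields, a strict map of `L∞` algebras. -/
structure IsStrictMap {V' : Type*} [AddCommGroup V'] [Module k V'] (𝒱 : Grading k V)
    (𝒱' : Grading k V') (Q : FormalMap k V V) (Q' : FormalMap k V' V') (f : V →ₗ[k] V') :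
    Prop where
  map_deg : ∀ i, ∀ x ∈ 𝒱.deg i, f x ∈ 𝒱'.deg i
  map_bracket : ∀ (m : ℕ) (v : Fin m → V), f (Q m v) = Q' m (fun i => f (v i))

end FormalMaps

/-! ### Formal moduli problems, symplectic structures, Lagrangians -/

/-- A formal moduli problem `X`, presented by an `L∞` algebra `𝔤`.  The graded space is the
tangent complex `V = 𝔤[1]` of `X` at its base point; the brackets `𝔤^{⊗m} → 𝔤[2-m]` become, by
décalage, graded symmetric maps `Q m : V^{⊗m} → V` of degree one, and the generalized Jacobi
identities `∑ₛ ± Q (Q (v_s), v_{sᶜ}) = 0` say that `Q` is a cohomological vector field. -/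
structure LInfinity {k : Type*} [Field k] {V : Type*} [AddCommGroup V] [Module k V]
    (𝒱 : Grading k V) where
  Q : FormalMap k V V
  symm : GradedSymm 𝒱 Q
  degree : FieldDegree 𝒱 1 Q
  zero : Q 0 = 0
  jacobi : ∀ m, derivAlong 𝒱 Q Q m = 0

section Geometry

variable {k : Type*} [Field k] {G : Type*} [AddCommGroup G] [Module k G]
  {T : Type*} [AddCommGroup T] [Module k T] {𝒢 : Grading k G} {𝒯 : Grading k T}

/-- A strict, constant coefficient `n`-shifted symplectic structure: a graded antisymmetric
pairing of degree `-n` on `𝔤[1]` (by décalage, a symmetric map `𝔤 → 𝔤^*[n-2]`), nondegenerate,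
and invariant: `ω (Q (v₁, …, vₘ), vₘ₊₁)` is graded symmetric in all arguments. -/
structure ShiftedSymplectic (X : LInfinity 𝒢) (n : ℤ) where
  form : G →ₗ[k] G →ₗ[k] k
  degree : ∀ a b : ℤ, a + b ≠ -n → ∀ x ∈ 𝒢.deg a, ∀ y ∈ 𝒢.deg b, form x y = 0
  antisymm : ∀ a b : ℤ, ∀ x ∈ 𝒢.deg a, ∀ y ∈ 𝒢.deg b,
    form x y = -((a * b).negOnePow • form y x)
  nondegenerate : Function.Bijective form
  invariant : GradedSymm 𝒢 (lower form X.Q)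

/-- A regular embedded Lagrangian: a strict, injective `L∞` map whose image equals its own
orthogonal complement. -/
structure IsRegularLagrangian {X : LInfinity 𝒢} {n : ℤ} (ω : ShiftedSymplectic X n)
    (L : LInfinity 𝒯) (f : T →ₗ[k] G) : Prop where
  strict : IsStrictMap 𝒯 𝒢 L.Q X.Q f
  injective : Function.Injective f
  isotropic : ∀ x y, ω.form (f x) (f y) = 0
  coisotropic : ∀ y, (∀ x, ω.form y (f x) = 0) → y ∈ LinearMap.range f

/-- `M` is a graded isotropic complement to the image of `f`. -/
structure IsIsotropicComplement {X : LInfinity 𝒢} {n : ℤ} (ω : ShiftedSymplectic X n)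
    (f : T →ₗ[k] G) (M : Submodule k G) : Prop where
  graded : M = ⨆ i, M ⊓ 𝒢.deg i
  compl : IsCompl (LinearMap.range f) M
  isotropic : ∀ x ∈ M, ∀ y ∈ M, ω.form x y = 0

end Geometry

/-! ### The shifted cotangent bundle and polyvector fields -/

section Cotangent

variable {k : Type*} [Field k] {T : Type*} [AddCommGroup T] [Module k T]

/-- The canonical `n`-shifted symplectic form on `T ⊕ T^*[n]`, namely
`ω ((x, ξ), (y, η)) = ξ y - (-1) ^ ((n + 1) * |x|) η x`. -/
def canonicalForm (𝒯 : Grading k T) (n : ℤ) :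
    (T × Module.Dual k T) →ₗ[k] (T × Module.Dual k T) →ₗ[k] k :=
  LinearMap.mk₂ k (fun e e' => e.2 e'.1 - e'.2 (𝒯.signOp (n + 1) e.1))
    (fun _ _ _ => by simp only [Prod.snd_add, Prod.fst_add, LinearMap.add_apply, map_add]; ring)
    (fun _ _ _ => by simp [mul_sub])
    (fun _ _ _ => by simp only [Prod.snd_add, Prod.fst_add, LinearMap.add_apply, map_add]; ring)
    (fun _ _ _ => by simp [mul_sub])

/-- The inverse of `canonicalForm`. -/
def sharp [FiniteDimensional k T] (𝒯 : Grading k T) (n : ℤ) :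
    Module.Dual k (T × Module.Dual k T) →ₗ[k] T × Module.Dual k T :=
  LinearMap.prod
    (-(𝒯.signOp (n + 1) ∘ₗ (Module.evalEquiv k T).symm.toLinearMap ∘ₗ
      (LinearMap.inr k T (Module.Dual k T)).dualMap))
    (LinearMap.inl k T (Module.Dual k T)).dualMap

theorem canonicalForm_sharp [FiniteDimensional k T] (𝒯 : Grading k T) (n : ℤ)
    (α : Module.Dual k (T × Module.Dual k T)) : canonicalForm 𝒯 n (sharp 𝒯 n α) = α := by
  refine LinearMap.ext fun e => ?_
  have h : ∀ η : Module.Dual k T, η ((Module.evalEquiv k T).symm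
      ((LinearMap.inr k T (Module.Dual k T)).dualMap α)) = α (0, η) := fun η => by
    rw [Module.apply_evalEquiv_symm_apply]; rfl
  obtain ⟨y, η⟩ := e
  change α (y, 0) - η (𝒯.signOp (n + 1) (-𝒯.signOp (n + 1) ((Module.evalEquiv k T).symm
    ((LinearMap.inr k T (Module.Dual k T)).dualMap α)))) = α (y, η)
  rw [map_neg, map_neg, Grading.signOp_signOp, h, sub_neg_eq_add]
  rw [← map_add]; simp

variable [FiniteDimensional k T]

/-- The Hamiltonian vector field of `F`: `ω (X_F (v₁, …, vₘ), u) = F (v₁, …, vₘ, u)`. -/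
def hamiltonian (𝒯 : Grading k T) (n : ℤ) (F : FormalMap k (T × Module.Dual k T) k) :
    FormalMap k (T × Module.Dual k T) (T × Module.Dual k T) :=
  fun m => (sharp 𝒯 n).compMultilinearMap (F (m + 1)).curryRight

/-- The Poisson bracket `{F, G} = X_F (G)` on functions on `T^*[n]L`, which is the Schouten
bracket of polyvector fields. -/
def schouten (𝒯 : Grading k T) (n : ℤ) (F H : FormalMap k (T × Module.Dual k T) k) :
    FormalMap k (T × Module.Dual k T) k :=
  derivAlong (𝒯.cotangent n) (hamiltonian 𝒯 n F) H

/-- The part of polynomial degree `j` in the fibre direction `T^*[n]`. -/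
def weightPart {W : Type*} [AddCommGroup W] [Module k W] (j : ℕ) {m : ℕ}
    (φ : MultilinearMap k (fun _ : Fin m => T × Module.Dual k T) W) :
    MultilinearMap k (fun _ : Fin m => T × Module.Dual k T) W :=
  ∑ A ∈ Finset.powersetCard j (Finset.univ : Finset (Fin m)),
    φ.compLinearMap fun i =>
      if i ∈ A then LinearMap.inr k T (Module.Dual k T) ∘ₗ LinearMap.snd k T (Module.Dual k T)
      else LinearMap.inl k T (Module.Dual k T) ∘ₗ LinearMap.fst k T (Module.Dual k T)

/-- Polyvector fields `∏_{j ≥ 2} Γ(L, Sym^j (T_L[-n]))` of cohomological degree `d`, as functions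
on `T^*[n]L` without components of fibre degree zero and one. -/
structure IsPolyvector (𝒯 : Grading k T) (n d : ℤ) (P : FormalMap k (T × Module.Dual k T) k) :
    Prop where
  symm : GradedSymm (𝒯.cotangent n) P
  degree : FunctionDegree (𝒯.cotangent n) d P
  weight_zero : ∀ m, weightPart 0 (P m) = 0
  weight_one : ∀ m, weightPart 1 (P m) = 0

/-- A vector field on `L`, viewed as a function on `T^*[n]L` linear along the fibres: the sum
`∑ᵢ ± ω ((Q (x₁, …, x̂ᵢ, …, xₘ), 0), (0, ξᵢ))`. -/
def linearFunction (𝒯 : Grading k T) (n : ℤ) (Q : FormalMap k T T) :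
    FormalMap k (T × Module.Dual k T) k :=
  derivAlong (𝒯.cotangent n)
    (fun m => (LinearMap.inl k T (Module.Dual k T)).compMultilinearMap
      ((Q m).compLinearMap fun _ => LinearMap.fst k T (Module.Dual k T)))
    (ofBilin ((canonicalForm 𝒯 n).compl₁₂
      (LinearMap.inl k T (Module.Dual k T) ∘ₗ LinearMap.fst k T (Module.Dual k T))
      (LinearMap.inr k T (Module.Dual k T) ∘ₗ LinearMap.snd k T (Module.Dual k T))))

variable {𝒯 : Grading k T}

/-- The mixed polyvector field `Q_𝔩 + P`. -/
def totalHamiltonian (L : LInfinity 𝒯) (n : ℤ) (P : FormalMap k (T × Module.Dual k T) k) :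
    FormalMap k (T × Module.Dual k T) k :=
  fun m => linearFunction 𝒯 n L.Q m + P m

/-- An `(n-1)`-shifted homotopy Poisson structure on `L`: a polyvector field `P` of degree
`n + 1` with components in `Sym^j (T_L[-n])`, `j ≥ 2`, satisfying `[Q + P, Q + P] = 0`. -/
structure IsHomotopyPoisson (L : LInfinity 𝒯) (n : ℤ)
    (P : FormalMap k (T × Module.Dual k T) k) : Prop where
  polyvector : IsPolyvector 𝒯 n (n + 1) P
  maurerCartan : ∀ m, schouten 𝒯 n (totalHamiltonian L n P) (totalHamiltonian L n P) m = 0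

/-- The vector field of the twisted cotangent bundle `T^*_P[n]L`; for `P = 0` this is the shifted
cotangent bundle `T^*[n]L` itself. -/
def twistedCotangent (L : LInfinity 𝒯) (n : ℤ) (P : FormalMap k (T × Module.Dual k T) k) :
    FormalMap k (T × Module.Dual k T) (T × Module.Dual k T) :=
  hamiltonian 𝒯 n (totalHamiltonian L n P)

/-- Gauge equivalence of homotopy Poisson structures: `Q + P' = exp [B, -] (Q + P)` for a
polyvector field `B` of degree `n`.  Bracketing with `B` raises the fibre degree and does not lower
the polynomial degree, so in polynomial degree `m` the terms with `r > m` vanish. -/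
def GaugeEquivalent (L : LInfinity 𝒯) (n : ℤ) (P P' : FormalMap k (T × Module.Dual k T) k) :
    Prop :=
  ∃ B, IsPolyvector 𝒯 n n B ∧ ∀ m, totalHamiltonian L n P' m =
    ∑ r ∈ Finset.range (m + 1),
      ((r.factorial : k)⁻¹) • ((schouten 𝒯 n B)^[r] (totalHamiltonian L n P)) m

/-- The polyvector field `∑_{j ≥ 2} c ^ (j - 1) P_j`. -/
def rescale (c : k) (P : FormalMap k (T × Module.Dual k T) k) :
    FormalMap k (T × Module.Dual k T) k :=
  fun m => ∑ j ∈ Finset.range (m + 1), c ^ (j - 1) • weightPart j (P m)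

/-- Dilation of the fibres of `T^*[n]L`. -/
def dilation (k T : Type*) [Field k] [AddCommGroup T] [Module k T] (c : k) :
    (T × Module.Dual k T) →ₗ[k] (T × Module.Dual k T) :=
  LinearMap.id.prodMap (c • LinearMap.id)

/-- Transport of polyvector fields along a linear isomorphism. -/
def pushforward {T' : Type*} [AddCommGroup T'] [Module k T'] (χ : T ≃ₗ[k] T')
    (P : FormalMap k (T × Module.Dual k T) k) : FormalMap k (T' × Module.Dual k T') k :=
  fun m => (P m).compLinearMap fun _ =>
    χ.symm.toLinearMap.prodMap χ.dualMap.toLinearMap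

variable {G : Type*} [AddCommGroup G] [Module k G] {𝒢 : Grading k G}

/-- A symplectic splitting: a graded linear symplectic isomorphism `T ⊕ T^*[n] ≅ 𝔤[1]` that
extends the embedding `f` of the zero section. -/
structure IsSplitting {X : LInfinity 𝒢} {n : ℤ} (ω : ShiftedSymplectic X n) (𝒯 : Grading k T)
    (f : T →ₗ[k] G) (Φ : (T × Module.Dual k T) ≃ₗ[k] G) : Prop where
  map_deg : ∀ i, ∀ e ∈ (𝒯.cotangent n).deg i, Φ e ∈ 𝒢.deg i
  zero_section : ∀ x, Φ (x, 0) = f x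
  symplectic : ∀ e e', ω.form (Φ e) (Φ e') = canonicalForm 𝒯 n e e'

/-- `P` is a homotopy Poisson structure on `L` and `Φ` is an isomorphism of `n`-shifted symplectic
formal moduli problems `T^*_P[n]L ≅ X` under `L`. -/
structure IsInducedPoisson {X : LInfinity 𝒢} {n : ℤ} (ω : ShiftedSymplectic X n)
    (L : LInfinity 𝒯) (f : T →ₗ[k] G) (Φ : (T × Module.Dual k T) ≃ₗ[k] G)
    (P : FormalMap k (T × Module.Dual k T) k) : Prop where
  splitting : IsSplitting ω 𝒯 f Φ
  poisson : IsHomotopyPoisson L n P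
  strict : IsStrictMap (𝒯.cotangent n) 𝒢 (twistedCotangent L n P) X.Q Φ.toLinearMap

end Cotangent

end

end FormalModuli

open FormalModuli

/-! The form `ω` turns the vector field `Q` of `X` into a Hamiltonian `H (v₁, …, vₘ₊₁) = ω (Q (v₁,
…, vₘ), vₘ₊₁)`, a graded symmetric function of degree `n + 1` that determines `Q` by nondegeneracy.
In the coordinates of a symplectic splitting `Φ`, the map `Φ` is strict for the Hamiltonian vector
field of a function exactly when that function agrees with `H ∘ Φ` in positive polynomial degree
(`IsSplitting.strict_iff`). So everything is read off from the fibre degrees of `H ∘ Φ`. Fibre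
degree zero vanishes because `f` is strict with isotropic image, fibre degree one is `Q_𝔩`
(`IsSplitting.linearFunction_eq`), and the rest is the only possible `P`. Pairing the Jacobi
identities with `ω` gives `Q (H) = 0` (`ShiftedSymplectic.derivAlong_lower`), which `Φ` carries to
the Maurer–Cartan equation.

Splittings come from degree-preserving sections `σ` of `w ↦ ω (w, f -)`; half of the defect `ω (σ -,
σ -)`, moved into the image of `f`, corrects a section to an isotropic one.

For `c ≠ 0`, dilating the fibres by `c` and replacing `ω` by `c⁻¹ ω` multiplies fibre degree `j` of
the Hamiltonian by `c ^ (j - 1)`, so `rescale c P` is the structure of another splitting. The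
Maurer–Cartan equation is polynomial in `c` and `k` is infinite, hence it persists at `c = 0`.

Two splittings are related by `Φ' = Φ ∘ (1 + N)`, where `N` kills `T`, takes values in `T`, and is
skew for the canonical form. Thus `N` is the Hamiltonian vector field of a quadratic bivector `B`.
As `N ^ 2 = 0`, pullback along `1 + N = exp N` is `exp [B, -]` (`schouten_ofBilin`,
`mixPart_one_mixPart`, `compLinearMap_add_smul`). -/

namespace FormalModuli

noncomputable section

/-! ### Homogeneous arguments -/

section Homogeneous

variable {k : Type*} [Field k] {V : Type*} [AddCommGroup V] [Module k V]
  {W : Type*} [AddCommGroup W] [Module k W]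

theorem Grading.mem_iSup (𝒱 : Grading k V) (x : V) : x ∈ ⨆ i, 𝒱.deg i := by
  rw [𝒱.internal.submodule_iSup_eq_top]; trivial

/-- Multilinear maps that agree on homogeneous arguments are equal. -/
theorem Grading.multilinear_ext (𝒱 : Grading k V) {m : ℕ}
    {φ ψ : MultilinearMap k (fun _ : Fin m => V) W}
    (h : ∀ (v : Fin m → V) (a : Fin m → ℤ), (∀ i, v i ∈ 𝒱.deg (a i)) → φ v = ψ v) : φ = ψ := by
  classical
  refine Module.Basis.ext_multilinear (fun _ => 𝒱.internal.collectedBasis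
    (fun i => Module.Basis.ofVectorSpace k (𝒱.deg i))) fun v => ?_
  exact h _ (fun i => (v i).1) fun i => 𝒱.internal.collectedBasis_mem _ (v i)

theorem Grading.linear_ext (𝒱 : Grading k V) {φ ψ : V →ₗ[k] W}
    (h : ∀ i, ∀ x ∈ 𝒱.deg i, φ x = ψ x) : φ = ψ := by
  refine LinearMap.ext fun x => ?_
  have hx := 𝒱.mem_iSup x
  induction hx using Submodule.iSup_induction' with
  | mem i x hx => exact h i x hx
  | zero => simp
  | add x y _ _ h₁ h₂ => simp [h₁, h₂]

theorem Grading.parityProj_of_mem (𝒱 : Grading k V) {i : ℤ} {x : V} (hx : x ∈ 𝒱.deg i) (b : Bool) :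
    𝒱.parityProj b x = if decide (Odd i) = b then x else 0 := by
  rw [parityProj, 𝒱.act_of_mem _ hx]
  split_ifs <;> simp

theorem Grading.map_act {𝒱 : Grading k V} {𝒲 : Grading k W} {f : V →ₗ[k] W}
    (hf : ∀ i, ∀ x ∈ 𝒱.deg i, f x ∈ 𝒲.deg i) (c : ℤ → k) (x : V) :
    f (𝒱.act c x) = 𝒲.act c (f x) := by
  have : f ∘ₗ 𝒱.act c = 𝒲.act c ∘ₗ f := 𝒱.linear_ext fun i x hx => by
    simp only [LinearMap.comp_apply, 𝒱.act_of_mem _ hx, 𝒲.act_of_mem _ (hf i x hx), map_smul]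
  exact LinearMap.congr_fun this x

/-- Projection to the component of degree `i`. -/
def Grading.proj (𝒱 : Grading k V) (i : ℤ) : V →ₗ[k] V :=
  𝒱.act fun j => if j = i then 1 else 0

theorem Grading.proj_of_mem (𝒱 : Grading k V) {i : ℤ} {x : V} (hx : x ∈ 𝒱.deg i) :
    𝒱.proj i x = x := by
  simp [proj, 𝒱.act_of_mem _ hx]

theorem Grading.proj_of_mem_ne (𝒱 : Grading k V) {i j : ℤ} (hij : j ≠ i) {x : V}
    (hx : x ∈ 𝒱.deg j) : 𝒱.proj i x = 0 := by
  simp [proj, 𝒱.act_of_mem _ hx, hij]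

theorem Grading.proj_mem_of_graded (𝒱 : Grading k V) {M : Submodule k V}
    (hM : M = ⨆ i, M ⊓ 𝒱.deg i) (i : ℤ) {x : V} (hx : x ∈ M) : 𝒱.proj i x ∈ M ⊓ 𝒱.deg i := by
  rw [hM] at hx
  induction hx using Submodule.iSup_induction' with
  | mem j x hx =>
    by_cases hij : j = i
    · subst hij
      rwa [𝒱.proj_of_mem hx.2]
    · rw [𝒱.proj_of_mem_ne hij hx.2]
      exact Submodule.zero_mem _
  | zero => simp
  | add x y _ _ h₁ h₂ => rw [map_add]; exact Submodule.add_mem _ h₁ h₂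

theorem Grading.proj_mem (𝒱 : Grading k V) (i : ℤ) (x : V) : 𝒱.proj i x ∈ 𝒱.deg i :=
  (𝒱.proj_mem_of_graded (M := ⊤) (by simp [𝒱.internal.submodule_iSup_eq_top]) i
    Submodule.mem_top).2

/-- An injective degree-preserving map reflects degrees. -/
theorem Grading.mem_of_map_mem {𝒱 : Grading k V} {𝒲 : Grading k W} {f : V →ₗ[k] W}
    (hf : ∀ i, ∀ x ∈ 𝒱.deg i, f x ∈ 𝒲.deg i) (hinj : Function.Injective f) {i : ℤ} {x : V}
    (hx : f x ∈ 𝒲.deg i) : x ∈ 𝒱.deg i := by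
  have : 𝒱.proj i x = x := hinj ((Grading.map_act hf _ x).trans (𝒲.proj_of_mem hx))
  rw [← this]
  exact 𝒱.proj_mem i x

/-- The degree-preserving part of a linear map. -/
def Grading.degreeZeroPart (𝒱 : Grading k V) (𝒲 : Grading k W) (s : V →ₗ[k] W) : V →ₗ[k] W :=
  DirectSum.toModule k ℤ W (fun i => 𝒲.proj i ∘ₗ s ∘ₗ (𝒱.deg i).subtype) ∘ₗ
    𝒱.decomp.symm.toLinearMap

theorem Grading.degreeZeroPart_of_mem (𝒱 : Grading k V) (𝒲 : Grading k W) (s : V →ₗ[k] W) {i : ℤ}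
    {x : V} (hx : x ∈ 𝒱.deg i) : 𝒱.degreeZeroPart 𝒲 s x = 𝒲.proj i (s x) := by
  have h : 𝒱.decomp.symm x = DirectSum.lof k ℤ (fun i => 𝒱.deg i) i ⟨x, hx⟩ := by
    rw [LinearEquiv.symm_apply_eq, decomp_lof]
  simp [degreeZeroPart, h, DirectSum.toModule_lof]

end Homogeneous

/-! ### Evaluation on lists -/

section Lists

variable {k : Type*} [Field k] {V : Type*} [AddCommGroup V] [Module k V]
  {W : Type*} [AddCommGroup W] [Module k W]

/-- The value of a formal map on the arguments listed in `l`. -/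
def evalList (φ : FormalMap k V W) (l : List V) : W := φ l.length l.get

/-- Unshuffles concatenate argument tuples whose lengths add up only propositionally. Lists avoid
the casts, and this is the way back to `Fin m`. -/
theorem evalList_eq (φ : FormalMap k V W) {l : List V} {m : ℕ} (h : l.length = m) {v : Fin m → V}
    (hv : ∀ i : Fin m, l[i] = v i) : evalList φ l = φ m v := by
  subst h
  exact congrArg _ (funext hv)

theorem evalList_ofFn (φ : FormalMap k V W) {m : ℕ} (v : Fin m → V) :
    evalList φ (List.ofFn v) = φ m v :=
  evalList_eq φ (List.length_ofFn) fun i => by simp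

theorem evalList_map_finRange (φ : FormalMap k V W) {m : ℕ} (v : Fin m → V) :
    evalList φ ((List.finRange m).map v) = φ m v := by
  rw [← List.ofFn_eq_map, evalList_ofFn]

theorem evalList_lower_append (ω : V →ₗ[k] V →ₗ[k] k) (Q : FormalMap k V V) (l : List V) (u : V) :
    evalList (lower ω Q) (l ++ [u]) = ω (evalList Q l) u := by
  rw [evalList_eq (lower ω Q) (m := l.length + 1) (v := Fin.snoc l.get u) (by simp)]
  · simp [lower, evalList]
  · intro i
    refine Fin.lastCases ?_ (fun i => ?_) i <;> simp

/-- The members of `l` are homogeneous, of the degrees listed in `a`. -/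
abbrev HomogeneousList (𝒱 : Grading k V) (l : List V) (a : List ℤ) : Prop :=
  List.Forall₂ (fun x d => x ∈ 𝒱.deg d) l a

theorem HomogeneousList.map {𝒱 : Grading k V} {ι : Type*} {v : ι → V} {a : ι → ℤ}
    (h : ∀ i, v i ∈ 𝒱.deg (a i)) (l : List ι) : HomogeneousList 𝒱 (l.map v) (l.map a) := by
  induction l with
  | nil => exact .nil
  | cons i l ih => exact .cons (h i) ih

theorem FieldDegree.evalList_mem {𝒱 : Grading k V} {d : ℤ} {Q : FormalMap k V V}
    (hQ : FieldDegree 𝒱 d Q) {l : List V} {a : List ℤ} (h : HomogeneousList 𝒱 l a) :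
    evalList Q l ∈ 𝒱.deg (d + a.sum) := by
  have hl := h.length_eq
  have := hQ l.length l.get (fun i => a.get (i.cast hl)) fun i => by
    have := List.forall₂_iff_get.1 h
    exact this.2 i i.2 (hl ▸ i.2)
  have hs : ∑ i, a.get (Fin.cast hl i) = a.sum := by
    exact (Equiv.sum_comp (finCongr hl) a.get).trans (by simp [Fin.sum_univ_getElem])
  rwa [hs] at this

theorem GradedSymm.evalList_swap {𝒱 : Grading k V} {φ : FormalMap k V W} (hφ : GradedSymm 𝒱 φ)
    (l₁ l₂ : List V) {x y : V} {a b : ℤ} (hx : x ∈ 𝒱.deg a) (hy : y ∈ 𝒱.deg b) :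
    evalList φ (l₁ ++ x :: y :: l₂) = (a * b).negOnePow • evalList φ (l₁ ++ y :: x :: l₂) := by
  have hlen : l₁.length + (l₂.length + 1 + 1) = (l₁ ++ y :: x :: l₂).length := by simp
  let i : Fin (l₁ ++ y :: x :: l₂).length := ⟨l₁.length, by omega⟩
  let j : Fin (l₁ ++ y :: x :: l₂).length := ⟨l₁.length + 1, by omega⟩
  -- Symmetry is applied to the list with `y` in front, so its swapped side is the left-hand side of
  -- the goal.
  have := hφ _ (l₁ ++ y :: x :: l₂).get i j rfl b a (by simpa [i] using hy) (by simpa [j] using hx)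
  rw [mul_comm a b]
  refine Eq.trans ?_ this
  refine evalList_eq φ (by simp) fun p => ?_
  by_cases hi : p = i
  · subst hi; simp [i, j]
  by_cases hj : p = j
  · subst hj; simp [i, j]
  have hi' : (p : ℕ) ≠ l₁.length := fun h => hi (Fin.ext h)
  have hj' : (p : ℕ) ≠ l₁.length + 1 := fun h => hj (Fin.ext h)
  simp only [Function.comp, Equiv.swap_apply_of_ne_of_ne hi hj, List.get_eq_getElem,
    Fin.getElem_fin, List.getElem_append]
  split_ifs with h
  · rfl
  · obtain ⟨q, hq⟩ : ∃ q, (p : ℕ) - l₁.length = q + 2 := ⟨p - l₁.length - 2, by omega⟩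
    simp [hq]

/-- Moving one argument to the left past the arguments in `l`. -/
theorem GradedSymm.evalList_move {𝒱 : Grading k V} {φ : FormalMap k V W} (hφ : GradedSymm 𝒱 φ)
    (l₁ l₂ : List V) {l : List V} {a : List ℤ} (hl : HomogeneousList 𝒱 l a) {y : V} {b : ℤ}
    (hy : y ∈ 𝒱.deg b) :
    evalList φ (l₁ ++ l ++ y :: l₂) = (a.sum * b).negOnePow • evalList φ (l₁ ++ y :: (l ++ l₂)) := by
  induction hl generalizing l₁ with
  | nil => simp
  | @cons x d l a hx hl ih =>
    have := ih (l₁ ++ [x])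
    simp only [List.append_assoc, List.cons_append, List.nil_append] at this ⊢
    rw [this, hφ.evalList_swap l₁ (l ++ l₂) hx hy, smul_smul, ← Int.negOnePow_add, List.sum_cons]
    congr 2
    ring

end Lists

/-! ### Koszul signs of unshuffles -/

section Unshuffle

/-- The members of `s` in increasing order. -/
def sublist {m : ℕ} (s : Finset (Fin m)) : List (Fin m) := (List.finRange m).filter (· ∈ s)

/-- The exponent of the Koszul sign of the unshuffle that moves the arguments indexed by `s` in
front of the others, for arguments of degrees `a`. -/
def koszulExponent {m : ℕ} (a : Fin m → ℤ) (s : Finset (Fin m)) : ℤ :=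
  ∑ x, ∑ y, if x ∉ s ∧ y ∈ s ∧ x < y then a x * a y else 0

/-- A subset of `Fin m` as a subset of `Fin (m + 1)` that does not contain the last element. -/
abbrev castSet {m : ℕ} (t : Finset (Fin m)) : Finset (Fin (m + 1)) := t.map Fin.castSuccEmb

theorem last_notMem_castSet {m : ℕ} (t : Finset (Fin m)) : Fin.last m ∉ castSet t := by
  simp

theorem castSet_compl {m : ℕ} (t : Finset (Fin m)) :
    (castSet t)ᶜ = insert (Fin.last m) (castSet tᶜ) := by
  ext i
  refine Fin.lastCases ?_ (fun i => ?_) i <;> simp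

theorem insert_last_castSet_compl {m : ℕ} (t : Finset (Fin m)) :
    (insert (Fin.last m) (castSet t))ᶜ = castSet tᶜ := by
  rw [← compl_inj_iff, compl_compl, castSet_compl, compl_compl]

theorem eq_castSet_or {m : ℕ} (s : Finset (Fin (m + 1))) :
    ∃ t, s = castSet t ∨ s = insert (Fin.last m) (castSet t) := by
  refine ⟨Finset.univ.filter fun i => i.castSucc ∈ s, ?_⟩
  by_cases h : Fin.last m ∈ s
  · right
    ext i
    refine Fin.lastCases ?_ (fun i => ?_) i <;> simp [h]
  · left
    ext i
    refine Fin.lastCases ?_ (fun i => ?_) i <;> simp [h]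

/-- Splitting by membership of the last index: `lower` singles out the last argument, so the master
equation divides along this line. -/
theorem sum_finset_succ {M : Type*} [AddCommMonoid M] {m : ℕ} (g : Finset (Fin (m + 1)) → M) :
    ∑ s, g s = ∑ t : Finset (Fin m), g (castSet t) +
      ∑ t : Finset (Fin m), g (insert (Fin.last m) (castSet t)) := by
  classical
  rw [← Finset.sum_filter_add_sum_filter_not Finset.univ (fun s => Fin.last m ∉ s)]
  have hc : Function.Injective (castSet (m := m)) := Finset.map_injective _
  have hi : Function.Injective fun t : Finset (Fin m) => insert (Fin.last m) (castSet t) :=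
    fun t t' h => hc (by
      have := congrArg (fun s => s.erase (Fin.last m)) h
      simpa [Finset.erase_insert (last_notMem_castSet _)] using this)
  congr 1
  · rw [← Finset.sum_image (s := Finset.univ) (g := castSet (m := m)) (fun _ _ _ _ h => hc h)]
    refine Finset.sum_congr (Finset.ext fun s => ?_) fun _ _ => rfl
    simp only [Finset.mem_filter, Finset.mem_univ, true_and, Finset.mem_image]
    constructor
    · intro h
      obtain ⟨t, rfl | rfl⟩ := eq_castSet_or s
      · exact ⟨t, rfl⟩
      · simp at h
    · rintro ⟨t, rfl⟩; exact last_notMem_castSet t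
  · rw [← Finset.sum_image (s := Finset.univ)
      (g := fun t : Finset (Fin m) => insert (Fin.last m) (castSet t)) (fun _ _ _ _ h => hi h)]
    refine Finset.sum_congr (Finset.ext fun s => ?_) fun _ _ => rfl
    simp only [Finset.mem_filter, Finset.mem_univ, true_and, Finset.mem_image, not_not]
    constructor
    · intro h
      obtain ⟨t, rfl | rfl⟩ := eq_castSet_or s
      · simp at h
      · exact ⟨t, rfl⟩
    · rintro ⟨t, rfl⟩; simp

theorem sublist_castSet {m : ℕ} (t : Finset (Fin m)) :
    sublist (castSet t) = (sublist t).map Fin.castSucc := by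
  simp [sublist, List.finRange_succ_last, List.filter_map, Function.comp_def]

theorem sublist_insert_last {m : ℕ} (t : Finset (Fin m)) :
    sublist (insert (Fin.last m) (castSet t)) =
      (sublist t).map Fin.castSucc ++ [Fin.last m] := by
  simp [sublist, List.finRange_succ_last, List.filter_map, Function.comp_def]

/-- The filter description suits recursion on the last index; the sorted one matches
`orderEmbOfFin`, which underlies `curryFinFinset`. -/
theorem sublist_eq_sort {m : ℕ} (s : Finset (Fin m)) : sublist s = s.sort := by
  refine List.Perm.eq_of_pairwise (le := (· ≤ ·)) (fun _ _ _ _ h h' => le_antisymm h h') ?_ ?_ ?_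
  · exact ((List.pairwise_le_finRange m).filter _)
  · exact s.pairwise_sort (· ≤ ·)
  · rw [sublist, List.perm_ext_iff_of_nodup ((List.nodup_finRange m).filter _) (s.sort_nodup _)]
    simp

theorem sum_map_sublist {m : ℕ} (a : Fin m → ℤ) (s : Finset (Fin m)) :
    ((sublist s).map a).sum = ∑ i ∈ s, a i := by
  rw [sublist_eq_sort, ← List.sum_toFinset _ (s.sort_nodup _), Finset.sort_toFinset]

theorem ofFn_orderEmbOfFin {V : Type*} {m : ℕ} (v : Fin m → V) (s : Finset (Fin m)) :
    List.ofFn (fun i => v (s.orderEmbOfFin rfl i)) = (sublist s).map v := by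
  rw [sublist_eq_sort]
  refine List.ext_getElem (by simp) fun i h₁ h₂ => ?_
  simp [Finset.orderEmbOfFin_apply]

theorem koszulExponent_castSet {m : ℕ} (a : Fin (m + 1) → ℤ) (t : Finset (Fin m)) :
    koszulExponent a (castSet t) = koszulExponent (fun i => a i.castSucc) t := by
  simp [koszulExponent, Fin.sum_univ_castSucc, not_lt.2 (Fin.le_last _)]

/-- The last argument, once selected, has to move left past every argument outside `t`. -/
theorem koszulExponent_insert_last {m : ℕ} (a : Fin (m + 1) → ℤ) (t : Finset (Fin m)) :
    koszulExponent a (insert (Fin.last m) (castSet t)) =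
      koszulExponent (fun i => a i.castSucc) t + (∑ i ∈ tᶜ, a i.castSucc) * a (Fin.last m) := by
  have h : ∀ i : Fin m, i.castSucc ∈ insert (Fin.last m) (castSet t) ↔ i ∈ t := by simp
  simp only [koszulExponent, Fin.sum_univ_castSucc, h, Finset.mem_insert_self, not_true, false_and,
    if_false, Finset.sum_const_zero, add_zero, Finset.sum_add_distrib, Fin.castSucc_lt_castSucc_iff,
    Fin.castSucc_lt_last, true_and, and_true, Finset.sum_mul, add_right_inj]
  rw [← Finset.sum_filter]
  exact Finset.sum_congr (by ext; simp) fun _ _ => rfl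

/-- Each pair with one index in `s` and one outside is inverted by exactly one of the two
complementary unshuffles. -/
theorem koszulExponent_add_compl {m : ℕ} (a : Fin m → ℤ) (s : Finset (Fin m)) :
    koszulExponent a s + koszulExponent a sᶜ = (∑ i ∈ s, a i) * ∑ i ∈ sᶜ, a i := by
  have h1 : (∑ i ∈ s, a i) * ∑ i ∈ sᶜ, a i =
      ∑ x, ∑ y, if x ∉ s ∧ y ∈ s then a x * a y else 0 := by
    rw [mul_comm, Finset.sum_mul_sum, ← Finset.sum_filter_add_sum_filter_not Finset.univ (· ∈ s)
      (fun x => ∑ y, if x ∉ s ∧ y ∈ s then a x * a y else 0)]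
    rw [Finset.sum_eq_zero (s := Finset.univ.filter (· ∈ s)), zero_add]
    · refine Finset.sum_congr (by ext; simp) fun x hx => ?_
      rw [← Finset.sum_filter]
      refine Finset.sum_congr ?_ fun _ _ => rfl
      ext y; simp at hx; simp [hx]
    · intro x hx
      simp at hx
      simp [hx]
  rw [h1, koszulExponent, koszulExponent]
  conv_lhs => arg 2; rw [Finset.sum_comm]
  rw [← Finset.sum_add_distrib]
  refine Finset.sum_congr rfl fun x _ => ?_
  rw [← Finset.sum_add_distrib]
  refine Finset.sum_congr rfl fun y _ => ?_
  by_cases hx : x ∈ s <;> by_cases hy : y ∈ s <;> simp [hx, hy]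
  rcases lt_trichotomy x y with h | h | h
  · simp [h, h.not_gt]
  · subst h; exact absurd hy hx
  · simp [h, h.not_gt, mul_comm]

/-- Replaces the product of signs by one integer exponent, so that later sign checks become parity
statements in `ℤ`. -/
theorem koszulSign_eq {m : ℕ} (s : Finset (Fin m)) (a : Fin m → ℤ) :
    koszulSign s (fun i => decide (Odd (a i))) = ((koszulExponent a s).negOnePow : ℤˣ) := by
  have hsum : koszulExponent a s =
      ∑ x ∈ (sᶜ ×ˢ s).filter (fun x => x.1 < x.2), a x.1 * a x.2 := by
    rw [koszulExponent, ← Fintype.sum_prod_type', ← Finset.sum_filter]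
    refine Finset.sum_congr ?_ fun _ _ => rfl
    ext x; simp [and_assoc]
  have hprod : ∀ S : Finset (Fin m × Fin m), (((∑ x ∈ S, a x.1 * a x.2).negOnePow : ℤˣ) : ℤ) =
      ∏ x ∈ S, if decide (Odd (a x.1)) && decide (Odd (a x.2)) then -1 else 1 := by
    classical
    intro S
    induction S using Finset.induction_on with
    | empty => simp
    | insert x S hx ih =>
      rw [Finset.sum_insert hx, Finset.prod_insert hx, Int.negOnePow_add, Units.val_mul, ih]
      congr 1
      by_cases h : Odd (a x.1 * a x.2)
      · rw [Int.negOnePow_odd _ h]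
        rw [Int.odd_mul] at h
        simp [h]
      · have h' := Int.not_odd_iff_even.1 h
        rw [Int.negOnePow_even _ h']
        rw [Int.odd_mul] at h
        simp only [Bool.and_eq_true, decide_eq_true_eq, h, if_false, Units.val_one]
  rw [hsum, hprod, koszulSign]

variable {k : Type*} [Field k] {V : Type*} [AddCommGroup V] [Module k V]
  {W : Type*} [AddCommGroup W] [Module k W]

theorem insertOne_apply (φ : FormalMap k V W) (X : FormalMap k V V) {m : ℕ} (s : Finset (Fin m))
    (v : Fin m → V) :
    insertOne φ X s v =
      evalList φ (evalList X ((sublist s).map v) :: (sublist sᶜ).map v) := by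
  rw [← ofFn_orderEmbOfFin, ← ofFn_orderEmbOfFin, evalList_ofFn, ← List.ofFn_cons, evalList_ofFn,
    insertOne, MultilinearMap.curryFinFinset_symm_apply]
  rfl

/-- On homogeneous arguments, `derivAlong` is a sum over unshuffles. -/
theorem derivAlong_apply {𝒱 : Grading k V} (X : FormalMap k V V) (φ : FormalMap k V W) {m : ℕ}
    {v : Fin m → V} {a : Fin m → ℤ} (h : ∀ i, v i ∈ 𝒱.deg (a i)) :
    derivAlong 𝒱 X φ m v = ∑ s : Finset (Fin m), (koszulExponent a s).negOnePow •
      evalList φ (evalList X ((sublist s).map v) :: (sublist sᶜ).map v) := by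
  simp only [derivAlong, sum_apply, smul_apply,
    MultilinearMap.compLinearMap_apply]
  -- Any other parity pattern projects some homogeneous argument to zero.
  rw [Finset.sum_eq_single fun i => decide (Odd (a i))]
  · refine Finset.sum_congr rfl fun s _ => ?_
    simp only [𝒱.parityProj_of_mem (h _), if_true, koszulSign_eq, insertOne_apply, Units.smul_def]
  · intro p _ hp
    obtain ⟨i, hi⟩ := Function.ne_iff.1 hp
    refine Finset.sum_eq_zero fun s _ => ?_
    rw [MultilinearMap.map_coord_zero _ i, smul_zero]
    rw [𝒱.parityProj_of_mem (h i), if_neg (Ne.symm hi)]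
  · simp

/-- Graded symmetric maps under unshuffles. -/
theorem GradedSymm.evalList_unshuffle {𝒱 : Grading k V} {φ : FormalMap k V W}
    (hφ : GradedSymm 𝒱 φ) {m : ℕ} {v : Fin m → V} {a : Fin m → ℤ} (h : ∀ i, v i ∈ 𝒱.deg (a i))
    (s : Finset (Fin m)) (l : List V) :
    evalList φ ((List.finRange m).map v ++ l) = (koszulExponent a s).negOnePow •
      evalList φ ((sublist s).map v ++ (sublist sᶜ).map v ++ l) := by
  -- The tail `l` is arbitrary because the induction peels the last argument off into it.
  induction m generalizing l with
  | zero => simp [koszulExponent, sublist]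
  | succ m ih =>
    have ih' := fun t l => ih (fun i => h (Fin.castSucc i)) t l
    have e : (List.finRange (m + 1)).map v ++ l =
        (List.finRange m).map (fun i => v i.castSucc) ++ (v (Fin.last m) :: l) := by
      simp [List.finRange_succ_last, Function.comp_def]
    obtain ⟨t, rfl | rfl⟩ := eq_castSet_or s
    · rw [e, ih' t, koszulExponent_castSet, castSet_compl, sublist_castSet, sublist_insert_last]
      simp [Function.comp_def]
    · rw [e, ih' t, koszulExponent_insert_last, insert_last_castSet_compl, sublist_castSet,
        sublist_insert_last, hφ.evalList_move _ _
          (HomogeneousList.map (fun i => h (Fin.castSucc i)) (sublist tᶜ)) (h (Fin.last m)),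
        sum_map_sublist, smul_smul, ← Int.negOnePow_add]
      simp [Function.comp_def]

theorem GradedSymm.apply_unshuffle {𝒱 : Grading k V} {φ : FormalMap k V W}
    (hφ : GradedSymm 𝒱 φ) {m : ℕ} {v : Fin m → V} {a : Fin m → ℤ} (h : ∀ i, v i ∈ 𝒱.deg (a i))
    (s : Finset (Fin m)) :
    φ m v = (koszulExponent a s).negOnePow •
      evalList φ ((sublist s).map v ++ (sublist sᶜ).map v) := by
  have := hφ.evalList_unshuffle h s []
  simpa [evalList_map_finRange] using this

end Unshuffle

/-! ### Functoriality and the classical master equation -/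

section Deriv

variable {k : Type*} [Field k] {V : Type*} [AddCommGroup V] [Module k V]
  {V' : Type*} [AddCommGroup V'] [Module k V'] {W : Type*} [AddCommGroup W] [Module k W]

/-- Pullback of formal maps along a linear map. -/
def pullback (f : V →ₗ[k] V') (φ : FormalMap k V' W) : FormalMap k V W :=
  fun m => (φ m).compLinearMap fun _ => f

theorem evalList_pullback (f : V →ₗ[k] V') (φ : FormalMap k V' W) (l : List V) :
    evalList (pullback f φ) l = evalList φ (l.map f) := by
  refine Eq.symm (evalList_eq φ (by simp) fun i => ?_)
  simp

theorem IsStrictMap.map_evalList {𝒱 : Grading k V} {𝒱' : Grading k V'} {X : FormalMap k V V}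
    {X' : FormalMap k V' V'} {f : V →ₗ[k] V'} (hf : IsStrictMap 𝒱 𝒱' X X' f) (l : List V) :
    f (evalList X l) = evalList X' (l.map f) := by
  rw [evalList, hf.map_bracket]
  refine Eq.symm (evalList_eq X' (by simp) fun i => ?_)
  simp

/-- Related vector fields have related derivatives. The signs agree because `f` preserves degrees.
This carries the master equation from `X` to the cotangent side. -/
theorem derivAlong_pullback {𝒱 : Grading k V} {𝒱' : Grading k V'} {X : FormalMap k V V}
    {X' : FormalMap k V' V'} {f : V →ₗ[k] V'} (hf : IsStrictMap 𝒱 𝒱' X X' f)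
    (φ : FormalMap k V' W) :
    derivAlong 𝒱 X (pullback f φ) = pullback f (derivAlong 𝒱' X' φ) := by
  funext m
  refine 𝒱.multilinear_ext fun v a h => ?_
  rw [derivAlong_apply X _ h]
  simp only [pullback, MultilinearMap.compLinearMap_apply]
  rw [derivAlong_apply X' φ fun i => hf.map_deg _ _ (h i)]
  refine Finset.sum_congr rfl fun s _ => ?_
  rw [evalList_pullback, List.map_cons, hf.map_evalList]
  simp [Function.comp_def]

theorem GradedSymm.pullback {𝒱 : Grading k V} {𝒱' : Grading k V'} {f : V →ₗ[k] V'}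
    (hf : ∀ i, ∀ x ∈ 𝒱.deg i, f x ∈ 𝒱'.deg i) {φ : FormalMap k V' W} (hφ : GradedSymm 𝒱' φ) :
    GradedSymm 𝒱 (pullback f φ) := fun m v i j hij a b hi hj =>
  hφ m (fun i => f (v i)) i j hij a b (hf _ _ hi) (hf _ _ hj)

theorem FunctionDegree.pullback {𝒱 : Grading k V} {𝒱' : Grading k V'} {f : V →ₗ[k] V'}
    (hf : ∀ i, ∀ x ∈ 𝒱.deg i, f x ∈ 𝒱'.deg i) {d : ℤ} {φ : FormalMap k V' k}
    (hφ : FunctionDegree 𝒱' d φ) : FunctionDegree 𝒱 d (pullback f φ) := fun m _ a h ha =>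
  hφ m _ a (fun i => hf _ _ (h i)) ha

variable {𝒱 : Grading k V} {X : LInfinity 𝒱} {n : ℤ}

/-- The Hamiltonian of an invariant cohomological vector field is annihilated by it. -/
theorem ShiftedSymplectic.derivAlong_lower (ω : ShiftedSymplectic X n) :
    derivAlong 𝒱 X.Q (lower ω.form X.Q) = 0 := by
  funext m
  refine 𝒱.multilinear_ext fun v a h => ?_
  rw [derivAlong_apply X.Q _ h]
  cases m with
  | zero =>
    have : evalList (lower ω.form X.Q) ([] ++ [evalList X.Q []]) = 0 := by
      rw [evalList_lower_append]
      have : evalList X.Q [] = 0 := by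
        change X.Q 0 _ = 0
        rw [X.zero]; rfl
      simp [this]
    exact Finset.sum_eq_zero fun s _ => by
      have e : (sublist s).map v = [] ∧ (sublist sᶜ).map v = [] := by simp [sublist]
      rw [e.1, e.2, ← List.nil_append [evalList X.Q []], this, smul_zero]
  | succ m =>
    have h' : ∀ i : Fin m, v i.castSucc ∈ 𝒱.deg (a i.castSucc) := fun i => h _
    have hJ : ∀ u : V, ∑ t : Finset (Fin m),
        (koszulExponent (fun i => a i.castSucc) t).negOnePow •
          ω.form (evalList X.Q (evalList X.Q ((sublist t).map fun i => v i.castSucc) ::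
            (sublist tᶜ).map fun i => v i.castSucc)) u = 0 := fun u => by
      have := congrArg (fun φ => ω.form (φ fun i => v i.castSucc) u) (X.jacobi m)
      simp only [derivAlong_apply X.Q X.Q h'] at this
      simpa [Units.smul_def] using this
    rw [sum_finset_succ]
    -- If the last argument `u` is not inserted into the inner `Q`, it stays in the last slot of
    -- `H`, and the sum is the Jacobi identity paired with `u`.
    have h₁ : ∑ t : Finset (Fin m), (koszulExponent a (castSet t)).negOnePow •
        evalList (lower ω.form X.Q) (evalList X.Q ((sublist (castSet t)).map v) ::
          (sublist (castSet t)ᶜ).map v) = 0 := by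
      rw [← hJ (v (Fin.last m))]
      refine Finset.sum_congr rfl fun t _ => ?_
      rw [koszulExponent_castSet, castSet_compl, sublist_castSet, sublist_insert_last,
        List.map_append, ← List.cons_append, List.map_singleton, evalList_lower_append]
      simp [Function.comp_def]
    -- If `u` is inserted, symmetry of `H` and antisymmetry of `ω` give `H (Q (A, u), B) = ± ω (Q B,
    -- Q (A, u)) = ± ω (Q (A, u), Q B) = ± ω (Q (Q B, A), u)`. This is the Jacobi sum again, indexed
    -- by the complementary subsets.
    have h₂ : ∑ t : Finset (Fin m), (koszulExponent a (insert (Fin.last m) (castSet t))).negOnePow •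
        evalList (lower ω.form X.Q)
          (evalList X.Q ((sublist (insert (Fin.last m) (castSet t))).map v) ::
            (sublist (insert (Fin.last m) (castSet t))ᶜ).map v) = 0 := by
      rw [← hJ (v (Fin.last m)), ← Equiv.sum_comp (compl_involutive (α := Finset (Fin m))).toPerm
        (fun t => (koszulExponent (fun i => a i.castSucc) t).negOnePow •
          ω.form (evalList X.Q (evalList X.Q ((sublist t).map fun i => v i.castSucc) ::
            (sublist tᶜ).map fun i => v i.castSucc)) (v (Fin.last m)))]
      refine Finset.sum_congr rfl fun t _ => ?_
      rw [koszulExponent_insert_last, insert_last_castSet_compl, sublist_castSet,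
        sublist_insert_last]
      simp only [Function.Involutive.coe_toPerm, compl_compl, List.map_append, List.map_map, List.map_singleton]
      set u := v (Fin.last m)
      set A := (sublist t).map fun i => v i.castSucc
      set B := (sublist tᶜ).map fun i => v i.castSucc
      have hu : u ∈ 𝒱.deg (a (Fin.last m)) := h _
      have hA : HomogeneousList 𝒱 A _ := HomogeneousList.map h' (sublist t)
      have hB : HomogeneousList 𝒱 B _ := HomogeneousList.map h' (sublist tᶜ)
      have hQB := X.degree.evalList_mem hB
      have hQA := X.degree.evalList_mem (List.rel_append hA (.cons hu .nil))
      have hκ := koszulExponent_add_compl (fun i => a i.castSucc) t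
      rw [List.sum_append, sum_map_sublist, List.sum_singleton] at hQA
      rw [sum_map_sublist] at hQB
      change _ • evalList (lower ω.form X.Q) (evalList X.Q (A ++ [u]) :: B) =
        _ • ω.form (evalList X.Q (evalList X.Q B :: A)) u
      have e₁ := ω.invariant.evalList_move [] [] hB hQA
      rw [List.nil_append, evalList_lower_append, ω.antisymm _ _ _ hQB _ hQA,
        ← evalList_lower_append, List.append_assoc, List.singleton_append,
        ω.invariant.evalList_swap _ _ hu hQB] at e₁
      have e₂ := ω.invariant.evalList_move [] [u] hA hQB
      rw [List.nil_append] at e₂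
      rw [e₂, List.nil_append, List.nil_append, List.append_nil, ← List.cons_append,
        evalList_lower_append, sum_map_sublist, sum_map_sublist] at e₁
      have hneg : ∀ z : k, -z = (1 : ℤ).negOnePow • z := by simp
      simp only [hneg, smul_smul, ← Int.negOnePow_add] at e₁
      rw [← inv_smul_eq_iff, smul_smul, Int.units_inv_eq_self, ← Int.negOnePow_add] at e₁
      rw [← e₁, smul_smul, ← Int.negOnePow_add]
      congr 1
      rw [Int.negOnePow_eq_iff]
      clear_value u A B
      generalize koszulExponent (fun i => a i.castSucc) t = κ at hκ ⊢
      generalize koszulExponent (fun i => a i.castSucc) tᶜ = κ' at hκ ⊢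
      generalize ∑ i ∈ t, a i.castSucc = p at hκ ⊢
      generalize ∑ i ∈ tᶜ, a i.castSucc = q at hκ ⊢
      generalize a (Fin.last m) = r
      -- Half the difference of the two sign exponents, after `κ + κ' = p * q` is used.
      exact ⟨κ + 2 * q * r + q + p * q + 1 + p + r, by linear_combination -hκ⟩
    rw [h₁, h₂]
    simp

end Deriv

/-! ### Symplectic splittings -/

section Splitting

variable {k : Type*} [Field k] {G : Type*} [AddCommGroup G] [Module k G] {𝒢 : Grading k G}
  {T : Type*} [AddCommGroup T] [Module k T] {𝒯 : Grading k T}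
  {X : LInfinity 𝒢} {n : ℤ} (ω : ShiftedSymplectic X n)

theorem ShiftedSymplectic.form_injective {x y : G} (h : ∀ z, ω.form x z = ω.form y z) : x = y :=
  ω.nondegenerate.1 (LinearMap.ext h)

theorem ShiftedSymplectic.form_proj {i j : ℤ} (x : G) {y : G} (hy : y ∈ 𝒢.deg j) :
    ω.form (𝒢.proj i x) y = if i + j = -n then ω.form x y else 0 := by
  have : ω.form.flip y ∘ₗ 𝒢.proj i = (if i + j = -n then (1 : k) else 0) • ω.form.flip y :=
    𝒢.linear_ext fun l x hx => by
      by_cases hl : l = i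
      · subst hl
        simp only [LinearMap.comp_apply, 𝒢.proj_of_mem hx, LinearMap.flip_apply,
          LinearMap.smul_apply]
        split_ifs with h
        · simp
        · simp [ω.degree l j h x hx y hy]
      · simp only [LinearMap.comp_apply, 𝒢.proj_of_mem_ne hl hx, map_zero, LinearMap.flip_apply,
          LinearMap.smul_apply]
        split_ifs with h
        · simp [ω.degree l j (by omega) x hx y hy]
        · simp
  have := LinearMap.congr_fun this x
  simp only [LinearMap.comp_apply, LinearMap.flip_apply, LinearMap.smul_apply] at this
  rw [this]
  split_ifs <;> simp

/-- By nondegeneracy, `z` equals its degree `i` component as soon as the two pair equally with all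
homogeneous vectors. -/
theorem ShiftedSymplectic.mem_deg {i : ℤ} {z : G}
    (h : ∀ j, i + j ≠ -n → ∀ y ∈ 𝒢.deg j, ω.form z y = 0) : z ∈ 𝒢.deg i := by
  have : 𝒢.proj i z = z := ω.nondegenerate.1 <| 𝒢.linear_ext fun j y hy => by
    rw [ω.form_proj z hy]
    split_ifs with hj
    · rfl
    · exact (h j hj y hy).symm
  rw [← this]
  exact 𝒢.proj_mem i z

variable {ω}

/-- The map `w ↦ ω (w, f -)`. -/
def restrictForm (ω : ShiftedSymplectic X n) (f : T →ₗ[k] G) : G →ₗ[k] Module.Dual k T :=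
  f.dualMap ∘ₗ ω.form

@[simp]
theorem restrictForm_apply (f : T →ₗ[k] G) (w : G) (x : T) :
    restrictForm ω f w x = ω.form w (f x) := rfl

variable {L : LInfinity 𝒯} {f : T →ₗ[k] G}

theorem IsRegularLagrangian.restrictForm_mem (hf : IsRegularLagrangian ω L f) {i : ℤ} {w : G}
    (hw : w ∈ 𝒢.deg i) :    restrictForm ω f w ∈ 𝒯.dualDeg n i := fun j hj x hx =>
  ω.degree i j (by omega) w hw _ (hf.strict.map_deg j x hx)

theorem IsRegularLagrangian.restrictForm_eq_zero (hf : IsRegularLagrangian ω L f) (w : G) :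
    restrictForm ω f w = 0 ↔ w ∈ LinearMap.range f := by
  constructor
  · exact fun h => hf.coisotropic w fun x => LinearMap.congr_fun h x
  · rintro ⟨x, rfl⟩
    exact LinearMap.ext fun y => hf.isotropic x y

theorem IsRegularLagrangian.restrictForm_surjective [FiniteDimensional k G]
    (hf : IsRegularLagrangian ω L f) : Function.Surjective (restrictForm ω f) :=
  (LinearMap.dualMap_surjective_of_injective hf.injective).comp ω.nondegenerate.2

end Splitting

/-! ### Isotropic sections, isotropic complements and splittings. -/

section Dual

variable {k : Type*} [Field k] {G : Type*} [AddCommGroup G] [Module k G] {𝒢 : Grading k G}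
  {T : Type*} [AddCommGroup T] [Module k T] [FiniteDimensional k T] {𝒯 : Grading k T}

theorem Grading.inr_mem {n i : ℤ} {ξ : Module.Dual k T} (hξ : ξ ∈ 𝒯.dualDeg n i) :
    ((0, ξ) : T × Module.Dual k T) ∈ (𝒯.cotangent n).deg i := ⟨Submodule.zero_mem _, hξ⟩

theorem Grading.inl_mem {n i : ℤ} {x : T} (hx : x ∈ 𝒯.deg i) :
    ((x, 0) : T × Module.Dual k T) ∈ (𝒯.cotangent n).deg i := ⟨hx, Submodule.zero_mem _⟩

theorem Grading.dual_ext (𝒯 : Grading k T) (n : ℤ) {φ ψ : Module.Dual k T →ₗ[k] G}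
    (h : ∀ i, ∀ ξ ∈ 𝒯.dualDeg n i, φ ξ = ψ ξ) : φ = ψ := by
  have := (𝒯.cotangent n).linear_ext (φ := φ ∘ₗ LinearMap.snd k T _)
    (ψ := ψ ∘ₗ LinearMap.snd k T _) fun i e he => h i e.2 he.2
  exact LinearMap.ext fun ξ => LinearMap.congr_fun this (0, ξ)

variable {X : LInfinity 𝒢} {n : ℤ} {ω : ShiftedSymplectic X n} {L : LInfinity 𝒯} {f : T →ₗ[k] G}

/-- A degree-preserving isotropic section of `w ↦ ω (w, f -)`. -/
structure IsIsotropicSection (ω : ShiftedSymplectic X n) (𝒯 : Grading k T) (f : T →ₗ[k] G)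
    (σ : Module.Dual k T →ₗ[k] G) : Prop where
  map_deg : ∀ i, ∀ ξ ∈ 𝒯.dualDeg n i, σ ξ ∈ 𝒢.deg i
  form_left : ∀ ξ, restrictForm ω f (σ ξ) = ξ
  isotropic : ∀ ξ η, ω.form (σ ξ) (σ η) = 0

/-- Accounts for the sign in `canonicalForm`: only degrees with `a + b = -n` pair, and then `a * b`
and `(n + 1) * a` have the same parity since `a * (a + 1)` is even. -/
theorem IsRegularLagrangian.form_section (hf : IsRegularLagrangian ω L f)
    {σ : Module.Dual k T →ₗ[k] G} (hd : ∀ i, ∀ ξ ∈ 𝒯.dualDeg n i, σ ξ ∈ 𝒢.deg i)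
    (hσ : ∀ ξ, restrictForm ω f (σ ξ) = ξ) (x : T) (η : Module.Dual k T) :
    ω.form (f x) (σ η) = -η (𝒯.signOp (n + 1) x) := by
  have h : ω.form.flip (σ η) ∘ₗ f = -(η ∘ₗ 𝒯.signOp (n + 1)) := 𝒯.linear_ext fun a x hx => by
    have : ω.form (f x) ∘ₗ σ =
        -(Module.Dual.eval k T (𝒯.signOp (n + 1) x)) := 𝒯.dual_ext n fun b η hη => by
      have hη' : η x = ω.form (σ η) (f x) := by
        rw [← restrictForm_apply (ω := ω), hσ]
      simp only [LinearMap.comp_apply, LinearMap.neg_apply, Module.Dual.eval_apply,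
        Grading.signOp, 𝒯.act_of_mem _ hx, map_smul, LinearMap.smul_apply]
      rw [ω.antisymm a b _ (hf.strict.map_deg a x hx) _ (hd b η hη), hη']
      by_cases hab : a + b = -n
      · have : (a * b).negOnePow = ((n + 1) * a).negOnePow := by
          rw [Int.negOnePow_eq_iff]
          obtain rfl : b = -n - a := by omega
          have h : a * (-n - a) - (n + 1) * a = -(a * (a + 1) + 2 * (n * a)) := by ring
          rw [h]
          exact ((Int.even_mul_succ_self a).add (even_two_mul (n * a))).neg
        rw [this, Units.smul_def, ← Int.cast_smul_eq_zsmul k]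
      · simp [ω.degree b a (by omega) _ (hd b η hη) _ (hf.strict.map_deg a x hx)]
    exact LinearMap.congr_fun this η
  exact LinearMap.congr_fun h x

/-- Take `Φ = f + σ`. It is bijective because `σ` splits `restrictForm ω f`, whose kernel is the
image of `f`. -/
theorem IsRegularLagrangian.exists_splitting (hf : IsRegularLagrangian ω L f)
    {σ : Module.Dual k T →ₗ[k] G} (hσ : IsIsotropicSection ω 𝒯 f σ) :
    ∃ Φ : (T × Module.Dual k T) ≃ₗ[k] G, IsSplitting ω 𝒯 f Φ ∧ ∀ ξ, Φ (0, ξ) = σ ξ := by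
  have hfr : ∀ x, restrictForm ω f (f x) = 0 := fun x => (hf.restrictForm_eq_zero _).2 ⟨x, rfl⟩
  have hb : Function.Bijective (f.coprod σ) := by
    constructor
    · rw [injective_iff_map_eq_zero]
      rintro ⟨x, ξ⟩ h
      have h' := congrArg (restrictForm ω f) h
      simp only [LinearMap.coprod_apply, map_add, hfr, hσ.form_left, zero_add, map_zero] at h'
      subst h'
      simp only [LinearMap.coprod_apply, map_zero, add_zero] at h
      rw [(injective_iff_map_eq_zero f).1 hf.injective x h]
      rfl
    · intro w
      obtain ⟨x, hx⟩ := (hf.restrictForm_eq_zero (w - σ (restrictForm ω f w))).1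
        (by rw [map_sub, hσ.form_left, sub_self])
      exact ⟨(x, restrictForm ω f w), by simp [hx]⟩
  refine ⟨LinearEquiv.ofBijective _ hb, ⟨?_, ?_, ?_⟩, ?_⟩
  · rintro i ⟨x, ξ⟩ ⟨hx, hξ⟩
    exact Submodule.add_mem _ (hf.strict.map_deg i x hx) (hσ.map_deg i ξ hξ)
  · intro x
    simp
  · rintro ⟨x, ξ⟩ ⟨y, η⟩
    have h₁ : ω.form (σ ξ) (f y) = ξ y := by rw [← restrictForm_apply (ω := ω), hσ.form_left]
    simp only [LinearEquiv.ofBijective_apply, LinearMap.coprod_apply, map_add, LinearMap.add_apply,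
      hf.isotropic, hσ.isotropic, hf.form_section hσ.map_deg hσ.form_left, h₁, canonicalForm,
      LinearMap.mk₂_apply]
    ring
  · intro ξ
    simp

theorem IsSplitting.restrictForm_inr {Φ : (T × Module.Dual k T) ≃ₗ[k] G}
    (hΦ : IsSplitting ω 𝒯 f Φ) (ξ : Module.Dual k T) : restrictForm ω f (Φ (0, ξ)) = ξ :=
  LinearMap.ext fun y => by
    rw [restrictForm_apply, ← hΦ.zero_section, hΦ.symplectic]
    simp [canonicalForm]

/-- The degree-zero part of a linear section is still a section `σ`. Let `ζ` represent its defect: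
`ω (ζ ξ, σ η) = ω (σ ξ, σ η)`, with `ζ` valued in the Lagrangian. Subtracting `ζ / 2` leaves the
section property intact; the two cross terms each remove half of the defect, and `ω (ζ, ζ)`
vanishes. -/
theorem IsRegularLagrangian.exists_isotropicSection [CharZero k] [FiniteDimensional k G]
    (hf : IsRegularLagrangian ω L f) : ∃ σ, IsIsotropicSection ω 𝒯 f σ := by
  obtain ⟨s, hs⟩ := (restrictForm ω f).exists_rightInverse_of_surjective
    (LinearMap.range_eq_top.2 hf.restrictForm_surjective)
  set σ : Module.Dual k T →ₗ[k] G :=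
    (𝒯.cotangent n).degreeZeroPart 𝒢 (s ∘ₗ LinearMap.snd k T _) ∘ₗ LinearMap.inr k T _ with hσdef
  have hσ : ∀ i, ∀ ξ ∈ 𝒯.dualDeg n i, σ ξ = 𝒢.proj i (s ξ) := fun i ξ hξ =>
    (𝒯.cotangent n).degreeZeroPart_of_mem 𝒢 _ (Grading.inr_mem hξ)
  have hd : ∀ i, ∀ ξ ∈ 𝒯.dualDeg n i, σ ξ ∈ 𝒢.deg i := fun i ξ hξ => by
    rw [hσ i ξ hξ]
    exact 𝒢.proj_mem i _
  have hr : restrictForm ω f ∘ₗ σ = LinearMap.id := 𝒯.dual_ext n fun i ξ hξ => by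
    refine 𝒯.linear_ext fun j x hx => ?_
    rw [LinearMap.comp_apply, restrictForm_apply, hσ i ξ hξ,
      ω.form_proj _ (hf.strict.map_deg j x hx), ← restrictForm_apply, ← LinearMap.comp_apply, hs]
    split_ifs with h
    · rfl
    · exact (hξ j (by omega) x hx).symm
  have hr' : ∀ ξ, restrictForm ω f (σ ξ) = ξ := fun ξ => LinearMap.congr_fun hr ξ
  -- the correction `ζ` takes values in the image of `f`
  let e := LinearEquiv.ofBijective ω.form ω.nondegenerate
  let ζ : Module.Dual k T →ₗ[k] G :=
    e.symm.toLinearMap ∘ₗ (σ ∘ₗ restrictForm ω f).dualMap ∘ₗ ω.form ∘ₗ σ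
  have hζ : ∀ ξ w, ω.form (ζ ξ) w = ω.form (σ ξ) (σ (restrictForm ω f w)) := fun ξ w =>
    LinearMap.congr_fun (e.apply_symm_apply ((σ ∘ₗ restrictForm ω f).dualMap (ω.form (σ ξ)))) w
  have hζf : ∀ ξ x, ω.form (ζ ξ) (f x) = 0 := fun ξ x => by
    rw [hζ, (hf.restrictForm_eq_zero _).2 ⟨x, rfl⟩, map_zero, map_zero]
  have hζr : ∀ ξ, ∃ x, f x = ζ ξ := fun ξ => hf.coisotropic _ (hζf ξ)
  have hζd : ∀ i, ∀ ξ ∈ 𝒯.dualDeg n i, ζ ξ ∈ 𝒢.deg i := fun i ξ hξ =>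
    ω.mem_deg fun j hj y hy => by
      rw [hζ]
      exact ω.degree i j hj _ (hd i ξ hξ) _ (hd j _ (hf.restrictForm_mem hy))
  have hζσ : ∀ ξ η, ω.form (ζ ξ) (σ η) = ω.form (σ ξ) (σ η) := fun ξ η => by rw [hζ, hr']
  have hζζ : ∀ ξ η, ω.form (ζ ξ) (ζ η) = 0 := fun ξ η => by
    obtain ⟨x, hx⟩ := hζr η
    rw [← hx, hζf]
  refine ⟨σ - (2 : k)⁻¹ • ζ, fun i ξ hξ => ?_, fun ξ => ?_, ?_⟩
  · exact Submodule.sub_mem _ (hd i ξ hξ) (Submodule.smul_mem _ _ (hζd i ξ hξ))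
  · obtain ⟨x, hx⟩ := hζr ξ
    rw [LinearMap.sub_apply, LinearMap.smul_apply, map_sub, map_smul, hr', ← hx,
      (hf.restrictForm_eq_zero _).2 ⟨x, rfl⟩, smul_zero, sub_zero]
  · have hσζ : ∀ i, ∀ ξ ∈ 𝒯.dualDeg n i, ∀ j, ∀ η ∈ 𝒯.dualDeg n j,
        ω.form (σ ξ) (ζ η) = ω.form (σ ξ) (σ η) := fun i ξ hξ j η hη => by
      rw [ω.antisymm i j _ (hd i ξ hξ) _ (hζd j η hη), hζσ,
        ω.antisymm i j _ (hd i ξ hξ) _ (hd j η hη)]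
    have : ω.form.compl₁₂ (σ - (2 : k)⁻¹ • ζ) (σ - (2 : k)⁻¹ • ζ) = 0 :=
      𝒯.dual_ext n fun i ξ hξ => 𝒯.dual_ext n fun j η hη => by
        simp only [LinearMap.compl₁₂_apply, LinearMap.sub_apply, LinearMap.smul_apply, map_sub,
          map_smul, hζζ, hζσ, hσζ i ξ hξ j η hη, LinearMap.zero_apply, smul_eq_mul]
        ring
    exact fun ξ η => LinearMap.congr_fun (LinearMap.congr_fun this ξ) η

theorem IsRegularLagrangian.isIsotropicComplement_range (hf : IsRegularLagrangian ω L f)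
    {σ : Module.Dual k T →ₗ[k] G} (hσ : IsIsotropicSection ω 𝒯 f σ) :
    IsIsotropicComplement ω f (LinearMap.range σ) where
  graded := by
    refine le_antisymm ?_ (iSup_le fun i => inf_le_left)
    rintro _ ⟨ξ, rfl⟩
    have h := (𝒯.cotangent n).mem_iSup (0, ξ)
    have hle : ⨆ i, (𝒯.cotangent n).deg i ≤
        (⨆ i, LinearMap.range σ ⊓ 𝒢.deg i).comap (σ ∘ₗ LinearMap.snd k T _) :=
      iSup_le fun i e he => Submodule.mem_iSup_of_mem i ⟨⟨e.2, rfl⟩, hσ.map_deg i _ he.2⟩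
    exact hle h
  compl := by
    constructor
    · rw [Submodule.disjoint_def]
      rintro _ hx ⟨ξ, rfl⟩
      have := (hf.restrictForm_eq_zero _).2 hx
      rw [hσ.form_left] at this
      rw [this, map_zero]
    · rw [codisjoint_iff, eq_top_iff]
      intro w _
      have := (hf.restrictForm_eq_zero (w - σ (restrictForm ω f w))).1
        (by rw [map_sub, hσ.form_left, sub_self])
      simpa using Submodule.add_mem_sup this (LinearMap.mem_range_self σ (restrictForm ω f w))
  isotropic := by
    rintro _ ⟨ξ, rfl⟩ _ ⟨η, rfl⟩
    exact hσ.isotropic ξ η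

/-- On a complement `M` of its kernel, `restrictForm ω f` is an isomorphism onto the dual. Its
inverse is the section, and no other section has values in `M`. -/
theorem IsRegularLagrangian.existsUnique_splitting [FiniteDimensional k G]
    (hf : IsRegularLagrangian ω L f) {M : Submodule k G} (hM : IsIsotropicComplement ω f M) :
    ∃! Φ : (T × Module.Dual k T) ≃ₗ[k] G, IsSplitting ω 𝒯 f Φ ∧ ∀ ξ, Φ (0, ξ) ∈ M := by
  have huniq : ∀ w ∈ M, ∀ w' ∈ M, restrictForm ω f w = restrictForm ω f w' → w = w' := by
    intro w hw w' hw' h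
    have hr := (hf.restrictForm_eq_zero (w - w')).1 (by rw [map_sub, h, sub_self])
    exact sub_eq_zero.1 (Submodule.disjoint_def.1 hM.compl.disjoint _ hr (M.sub_mem hw hw'))
  have hb : Function.Bijective (restrictForm ω f ∘ₗ M.subtype) := by
    refine ⟨fun w w' h => Subtype.ext (huniq _ w.2 _ w'.2 h), fun ξ => ?_⟩
    obtain ⟨w, rfl⟩ := hf.restrictForm_surjective ξ
    have hw : w ∈ LinearMap.range f ⊔ M := by rw [hM.compl.sup_eq_top]; trivial
    obtain ⟨x, hx, y, hy, rfl⟩ := Submodule.mem_sup.1 hw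
    refine ⟨⟨y, hy⟩, ?_⟩
    rw [map_add, (hf.restrictForm_eq_zero x).2 hx, zero_add]
    rfl
  let e := LinearEquiv.ofBijective _ hb
  have he : ∀ ξ, restrictForm ω f (e.symm ξ) = ξ := fun ξ => e.apply_symm_apply ξ
  have hσ : IsIsotropicSection ω 𝒯 f (M.subtype ∘ₗ e.symm.toLinearMap) := by
    refine ⟨fun i ξ hξ => ?_, he, fun ξ η => hM.isotropic _ (e.symm ξ).2 _ (e.symm η).2⟩
    have hp := 𝒢.proj_mem_of_graded hM.graded i (e.symm ξ).2
    -- Gradedness of `M` keeps the projection inside `M`, and it restricts to the same functional,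
    -- so injectivity on `M` applies.
    have : 𝒢.proj i (e.symm ξ) = e.symm ξ := huniq _ hp.1 _ (e.symm ξ).2 <|
      𝒯.linear_ext fun j x hx => by
        rw [restrictForm_apply, ω.form_proj _ (hf.strict.map_deg j x hx), ← restrictForm_apply, he]
        split_ifs with h
        · rfl
        · exact (hξ j (by omega) x hx).symm
    change ((e.symm ξ : M) : G) ∈ _
    rw [← this]
    exact hp.2
  obtain ⟨Φ, hΦ, hΦσ⟩ := hf.exists_splitting hσ
  have hΦM : ∀ ξ, Φ (0, ξ) ∈ M := fun ξ => by
    rw [hΦσ]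
    exact (e.symm ξ).2
  refine ⟨Φ, ⟨hΦ, hΦM⟩, fun Φ' h => LinearEquiv.ext fun p => ?_⟩
  have hp : p = (p.1, 0) + (0, p.2) := by simp
  rw [hp, map_add, map_add, hΦ.zero_section, h.1.zero_section]
  congr 1
  exact huniq _ (h.2 _) _ (hΦM _) (by rw [hΦ.restrictForm_inr, h.1.restrictForm_inr])

end Dual

/-! ### Distributing two linear maps over the arguments -/

section MixPart

variable {k : Type*} [Field k] {V : Type*} [AddCommGroup V] [Module k V]
  {V' : Type*} [AddCommGroup V'] [Module k V'] {W : Type*} [AddCommGroup W] [Module k W]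

/-- The sum over all ways to apply `g` to `j` of the arguments and `h` to the others. -/
def mixPart (g h : V →ₗ[k] V') (j : ℕ) {m : ℕ} (φ : MultilinearMap k (fun _ : Fin m => V') W) :
    MultilinearMap k (fun _ : Fin m => V) W :=
  ∑ A ∈ Finset.powersetCard j (Finset.univ : Finset (Fin m)),
    φ.compLinearMap fun i => if i ∈ A then g else h

theorem mixPart_apply (g h : V →ₗ[k] V') (j : ℕ) {m : ℕ}
    (φ : MultilinearMap k (fun _ : Fin m => V') W) (v : Fin m → V) :
    mixPart g h j φ v = ∑ A ∈ Finset.powersetCard j (Finset.univ : Finset (Fin m)),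
      φ fun i => if i ∈ A then g (v i) else h (v i) := by
  simp only [mixPart, sum_apply, MultilinearMap.compLinearMap_apply]
  refine Finset.sum_congr rfl fun A _ => congrArg φ (funext fun i => ?_)
  split_ifs <;> rfl

theorem mixPart_one_apply (g h : V →ₗ[k] V') {m : ℕ}
    (φ : MultilinearMap k (fun _ : Fin m => V') W) (v : Fin m → V) :
    mixPart g h 1 φ v = ∑ i, φ fun j => if j = i then g (v j) else h (v j) := by
  rw [mixPart_apply, Finset.powersetCard_one, Finset.sum_map]
  simp

theorem mixPart_sub (g h : V →ₗ[k] V') (j : ℕ) {m : ℕ}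
    (φ ψ : MultilinearMap k (fun _ : Fin m => V') W) :
    mixPart g h j (φ - ψ) = mixPart g h j φ - mixPart g h j ψ := by
  ext v
  simp [mixPart_apply]

theorem mixPart_smul (g h : V →ₗ[k] V') (j : ℕ) (c : k) {m : ℕ}
    (φ : MultilinearMap k (fun _ : Fin m => V') W) :
    mixPart g h j (c • φ) = c • mixPart g h j φ := by
  ext v
  simp [mixPart_apply, Finset.smul_sum]

theorem mixPart_sum (g h : V →ₗ[k] V') (j : ℕ) {m : ℕ} {ι : Type*} (S : Finset ι)
    (φ : ι → MultilinearMap k (fun _ : Fin m => V') W) :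
    mixPart g h j (∑ i ∈ S, φ i) = ∑ i ∈ S, mixPart g h j (φ i) := by
  ext v
  simp only [mixPart_apply, sum_apply]
  exact Finset.sum_comm

theorem mixPart_of_lt (g h : V →ₗ[k] V') {j m : ℕ} (hj : m < j)
    (φ : MultilinearMap k (fun _ : Fin m => V') W) : mixPart g h j φ = 0 := by
  rw [mixPart, Finset.powersetCard_eq_empty.2 (by simpa using hj), Finset.sum_empty]

/-- Multilinear binomial expansion. It serves twice: for fibre dilations, with `h` and `g` the base
and fibre projections, and for the change of splitting, with `h = id` and `g = N`. -/
theorem compLinearMap_add_smul (g h : V →ₗ[k] V') (c : k) {m : ℕ}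
    (φ : MultilinearMap k (fun _ : Fin m => V') W) :
    φ.compLinearMap (fun _ => h + c • g) =
      ∑ j ∈ Finset.range (m + 1), c ^ j • mixPart g h j φ := by
  ext v
  have e : (fun i => (h + c • g) (v i)) = (fun i => c • g (v i)) + fun i => h (v i) := by
    ext i; simp [add_comm]
  rw [MultilinearMap.compLinearMap_apply, e, φ.map_add_univ, ← Finset.powerset_univ,
    Finset.sum_powerset, Finset.card_univ, Fintype.card_fin]
  simp only [sum_apply, smul_apply, mixPart_apply, Finset.smul_sum]
  refine Finset.sum_congr rfl fun j _ => Finset.sum_congr rfl fun A hA => ?_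
  have e' : A.piecewise (fun i => c • g (v i)) (fun i => h (v i)) =
      A.piecewise (fun i => c • if i ∈ A then g (v i) else h (v i))
        fun i => if i ∈ A then g (v i) else h (v i) := by
    ext i
    by_cases hi : i ∈ A <;> simp [hi]
  rw [e', φ.map_piecewise_smul, Finset.prod_const, (Finset.mem_powersetCard.1 hA).2]

theorem GradedSymm.mixPart {𝒱 : Grading k V} {𝒱' : Grading k V'} {g h : V →ₗ[k] V'}
    (hg : ∀ i, ∀ x ∈ 𝒱.deg i, g x ∈ 𝒱'.deg i) (hh : ∀ i, ∀ x ∈ 𝒱.deg i, h x ∈ 𝒱'.deg i)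
    {φ : FormalMap k V' W} (hφ : GradedSymm 𝒱' φ) (r : ℕ) :
    GradedSymm 𝒱 fun m => mixPart g h r (φ m) := by
  intro m v i j hij a b hi hj
  simp only [mixPart_apply, Finset.smul_sum]
  -- Swapping two arguments permutes the subsets on which `g` acts.
  refine Finset.sum_equiv (Equiv.swap i j).finsetCongr (fun A => ?_) fun A _ => ?_
  · simp
  · have hmem : ∀ l x y, x ∈ 𝒱.deg l → (if y ∈ A.map (Equiv.swap i j).toEmbedding then g x else h x)
        ∈ 𝒱'.deg l := fun l x y hx => by
      split_ifs
      exacts [hg l x hx, hh l x hx]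
    refine Eq.trans ?_ (hφ m _ i j hij a b (hmem a _ i hi) (hmem b _ j hj))
    refine congrArg (φ m) (funext fun l => ?_)
    simp [Finset.mem_map_equiv]

theorem FunctionDegree.mixPart {𝒱 : Grading k V} {𝒱' : Grading k V'} {g h : V →ₗ[k] V'}
    (hg : ∀ i, ∀ x ∈ 𝒱.deg i, g x ∈ 𝒱'.deg i) (hh : ∀ i, ∀ x ∈ 𝒱.deg i, h x ∈ 𝒱'.deg i)
    {d : ℤ} {φ : FormalMap k V' k} (hφ : FunctionDegree 𝒱' d φ) (r : ℕ) :
    FunctionDegree 𝒱 d fun m => mixPart g h r (φ m) := by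
  intro m v a hv ha
  simp only [mixPart_apply]
  refine Finset.sum_eq_zero fun A _ => hφ m _ a (fun i => ?_) ha
  split_ifs
  exacts [hg _ _ (hv i), hh _ _ (hv i)]

/-- Since `N ^ 2 = 0`, a further `N` must hit a new argument. Each set of `r + 1` arguments then
arises `r + 1` times, once for each choice of the argument hit last. Hence the `r`-th iterate of the
derivation carries the factor `r!`. -/
theorem mixPart_one_mixPart {N : V →ₗ[k] V} (hN : ∀ x, N (N x) = 0) (r : ℕ) {m : ℕ}
    (φ : MultilinearMap k (fun _ : Fin m => V) W) :
    mixPart N LinearMap.id 1 (mixPart N LinearMap.id r φ) =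
      ((r + 1 : ℕ) : k) • mixPart N LinearMap.id (r + 1) φ := by
  ext v
  let Γ : Finset (Fin m) → W := fun S => φ fun i => if i ∈ S then N (v i) else v i
  have h₁ : ∀ i : Fin m, mixPart N LinearMap.id r φ
      (fun j => if j = i then N (v j) else (LinearMap.id : V →ₗ[k] V) (v j)) =
      ∑ A ∈ (Finset.powersetCard r (Finset.univ : Finset (Fin m))).filter (i ∉ ·),
        Γ (insert i A) := by
    intro i
    rw [mixPart_apply, Finset.sum_filter]
    refine Finset.sum_congr rfl fun A _ => ?_
    split_ifs with hi
    · refine φ.map_coord_zero i ?_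
      simp [hi, hN]
    · refine congrArg φ (funext fun j => ?_)
      by_cases hj : j = i
      · subst hj; simp [hi]
      · simp [hj]
  rw [mixPart_one_apply, Finset.sum_congr rfl fun i _ => h₁ i, smul_apply, mixPart_apply,
    Finset.smul_sum]
  have h₂ : ∀ S ∈ Finset.powersetCard (r + 1) (Finset.univ : Finset (Fin m)),
      ((r + 1 : ℕ) : k) • (φ fun i => if i ∈ S then N (v i) else (LinearMap.id : V →ₗ[k] V) (v i)) =
        ∑ _i ∈ S, Γ S := fun S hS => by
    rw [Finset.sum_const, (Finset.mem_powersetCard.1 hS).2, Nat.cast_smul_eq_nsmul]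
    rfl
  rw [Finset.sum_congr rfl h₂, Finset.sum_sigma', Finset.sum_sigma']
  refine Finset.sum_bij' (fun p _ => ⟨insert p.1 p.2, p.1⟩) (fun p _ => ⟨p.2, p.1.erase p.2⟩)
    ?_ ?_ ?_ ?_ ?_
  · rintro ⟨i, A⟩ h
    simp only [Finset.mem_sigma, Finset.mem_univ, true_and, Finset.mem_filter,
      Finset.mem_powersetCard, Finset.subset_univ] at h ⊢
    simp [Finset.card_insert_of_notMem h.2, h.1]
  · rintro ⟨S, i⟩ h
    simp only [Finset.mem_sigma, Finset.mem_univ, true_and, Finset.mem_filter,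
      Finset.mem_powersetCard, Finset.subset_univ] at h ⊢
    simp [Finset.card_erase_of_mem h.2, h.1]
  · rintro ⟨i, A⟩ h
    simp only [Finset.mem_sigma, Finset.mem_univ, true_and, Finset.mem_filter,
      Finset.mem_powersetCard, Finset.subset_univ] at h
    simp [Finset.erase_insert h.2]
  · rintro ⟨S, i⟩ h
    simp [Finset.insert_erase (Finset.mem_sigma.1 h).2]
  · rintro ⟨i, A⟩ h
    rfl

end MixPart

/-! ### Fibre degree -/

section Weight

variable {k : Type*} [Field k] {T : Type*} [AddCommGroup T] [Module k T]
  {W : Type*} [AddCommGroup W] [Module k W]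

/-- Replace the arguments indexed by `A` by their fibre components and the others by their base
components. -/
def splitArgs {m : ℕ} (A : Finset (Fin m)) (e : Fin m → T × Module.Dual k T) :
    Fin m → T × Module.Dual k T :=
  fun i => if i ∈ A then (0, (e i).2) else ((e i).1, 0)

theorem weightPart_eq_mixPart (j : ℕ) {m : ℕ}
    (φ : MultilinearMap k (fun _ : Fin m => T × Module.Dual k T) W) :
    weightPart j φ =
      mixPart (LinearMap.inr k T (Module.Dual k T) ∘ₗ LinearMap.snd k T (Module.Dual k T))
        (LinearMap.inl k T (Module.Dual k T) ∘ₗ LinearMap.fst k T (Module.Dual k T)) j φ := rfl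

theorem weightPart_apply (j : ℕ) {m : ℕ}
    (φ : MultilinearMap k (fun _ : Fin m => T × Module.Dual k T) W)
    (e : Fin m → T × Module.Dual k T) :
    weightPart j φ e = ∑ A ∈ Finset.powersetCard j (Finset.univ : Finset (Fin m)),
      φ (splitArgs A e) := by
  rw [weightPart_eq_mixPart, mixPart_apply]
  rfl

/-- Splitting along two different subsets annihilates some argument. This makes the fibre degree
components orthogonal projections. -/
theorem weightPart_splitArgs (j : ℕ) {m : ℕ}
    (φ : MultilinearMap k (fun _ : Fin m => T × Module.Dual k T) W) (A : Finset (Fin m))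
    (e : Fin m → T × Module.Dual k T) :
    weightPart j φ (splitArgs A e) = if A.card = j then φ (splitArgs A e) else 0 := by
  have h₀ : ∀ B, B ≠ A → φ (splitArgs B (splitArgs A e)) = 0 := fun B hB => by
    obtain ⟨i, hi⟩ : ∃ i, ¬(i ∈ B ↔ i ∈ A) := by
      by_contra! h
      exact hB (Finset.ext h)
    refine φ.map_coord_zero i ?_
    by_cases hiB : i ∈ B <;> by_cases hiA : i ∈ A <;> simp_all [splitArgs]
  have h₁ : splitArgs A (splitArgs A e) = splitArgs A e := by
    ext1 i
    by_cases hi : i ∈ A <;> simp [splitArgs, hi]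
  rw [weightPart_apply]
  split_ifs with h
  · rw [Finset.sum_eq_single A (fun B _ hB => h₀ B hB), h₁]
    intro hA
    simp [h] at hA
  · refine Finset.sum_eq_zero fun B hB => h₀ B ?_
    rintro rfl
    exact h (Finset.mem_powersetCard.1 hB).2

theorem weightPart_weightPart (i j : ℕ) {m : ℕ}
    (φ : MultilinearMap k (fun _ : Fin m => T × Module.Dual k T) W) :
    weightPart i (weightPart j φ) = if i = j then weightPart j φ else 0 := by
  ext e
  rw [weightPart_apply]
  simp only [weightPart_splitArgs]
  split_ifs with h
  · subst h
    rw [weightPart_apply]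
    exact Finset.sum_congr rfl fun A hA => by rw [if_pos (Finset.mem_powersetCard.1 hA).2]
  · exact Finset.sum_eq_zero fun A hA => by
      rw [if_neg (by rw [(Finset.mem_powersetCard.1 hA).2]; exact h)]

theorem weightPart_eq_zero {j m : ℕ}
    {φ : MultilinearMap k (fun _ : Fin m => T × Module.Dual k T) W}
    (h : ∀ A, A.card = j → ∀ e, φ (splitArgs A e) = 0) : weightPart j φ = 0 := by
  ext e
  rw [weightPart_apply]
  exact Finset.sum_eq_zero fun A hA => h A (Finset.mem_powersetCard.1 hA).2 e

theorem compLinearMap_dilation (c : k) {m : ℕ}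
    (φ : MultilinearMap k (fun _ : Fin m => T × Module.Dual k T) W) :
    φ.compLinearMap (fun _ => dilation k T c) =
      ∑ j ∈ Finset.range (m + 1), c ^ j • weightPart j φ := by
  simp only [weightPart_eq_mixPart, ← compLinearMap_add_smul]
  congr 1
  ext i : 2 <;> ext <;> simp [dilation]

theorem sum_weightPart {m : ℕ} (φ : MultilinearMap k (fun _ : Fin m => T × Module.Dual k T) W) :
    ∑ j ∈ Finset.range (m + 1), weightPart j φ = φ := by
  have := compLinearMap_dilation 1 φ
  simp only [one_pow, one_smul] at this
  rw [← this]
  ext e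
  simp [dilation]

theorem weightPart_compLinearMap {T' : Type*} [AddCommGroup T'] [Module k T'] (p : T' →ₗ[k] T)
    (q : Module.Dual k T' →ₗ[k] Module.Dual k T) (j : ℕ) {m : ℕ}
    (φ : MultilinearMap k (fun _ : Fin m => T × Module.Dual k T) W) :
    weightPart j (φ.compLinearMap fun _ => p.prodMap q) =
      (weightPart j φ).compLinearMap fun _ => p.prodMap q := by
  ext e
  simp only [MultilinearMap.compLinearMap_apply, weightPart_apply]
  refine Finset.sum_congr rfl fun A _ => congrArg φ (funext fun i => ?_)
  simp only [splitArgs]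
  split_ifs <;> simp

variable [FiniteDimensional k T] {𝒯 : Grading k T} {n : ℤ}

theorem GradedSymm.weightPart {φ : FormalMap k (T × Module.Dual k T) W}
    (hφ : GradedSymm (𝒯.cotangent n) φ) (j : ℕ) :
    GradedSymm (𝒯.cotangent n) fun m => weightPart j (φ m) :=
  hφ.mixPart (𝒱 := 𝒯.cotangent n) (fun _ _ hx => Grading.inr_mem hx.2)
    (fun _ _ hx => Grading.inl_mem hx.1) j

theorem FunctionDegree.weightPart {d : ℤ} {φ : FormalMap k (T × Module.Dual k T) k}
    (hφ : FunctionDegree (𝒯.cotangent n) d φ) (j : ℕ) :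
    FunctionDegree (𝒯.cotangent n) d fun m => weightPart j (φ m) :=
  hφ.mixPart (𝒱 := 𝒯.cotangent n) (fun _ _ hx => Grading.inr_mem hx.2)
    (fun _ _ hx => Grading.inl_mem hx.1) j

theorem splitArgs_mem {m : ℕ} {e : Fin m → T × Module.Dual k T} {a : Fin m → ℤ}
    (h : ∀ i, e i ∈ (𝒯.cotangent n).deg (a i)) (A : Finset (Fin m)) (i : Fin m) :
    splitArgs A e i ∈ (𝒯.cotangent n).deg (a i) := by
  simp only [splitArgs]
  split_ifs
  exacts [Grading.inr_mem (h i).2, Grading.inl_mem (h i).1]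

end Weight

/-! ### Quadratic functions -/

section Bilin

variable {k : Type*} [Field k] {V : Type*} [AddCommGroup V] [Module k V]

theorem ofBilin_two (B : V →ₗ[k] V →ₗ[k] k) (v : Fin 2 → V) : ofBilin B 2 v = B (v 0) (v 1) := rfl

theorem ofBilin_of_ne (B : V →ₗ[k] V →ₗ[k] k) {m : ℕ} (hm : m ≠ 2) : ofBilin B m = 0 := by
  match m, hm with
  | 0, _ => rfl
  | 1, _ => rfl
  | m + 3, _ => rfl

theorem length_sublist {m : ℕ} (s : Finset (Fin m)) : (sublist s).length = s.card := by
  rw [sublist_eq_sort, Finset.length_sort]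

theorem sublist_singleton {m : ℕ} (i : Fin m) : sublist {i} = [i] := by
  rw [sublist_eq_sort, Finset.sort_singleton]

theorem mem_sublist {m : ℕ} {s : Finset (Fin m)} {i : Fin m} : i ∈ sublist s ↔ i ∈ s := by
  simp [sublist]

theorem sum_eq_sum_powersetCard_one {M : Type*} [AddCommMonoid M] {m : ℕ} (g : Finset (Fin m) → M)
    (h : ∀ s, s.card ≠ 1 → g s = 0) : ∑ s, g s = ∑ i, g {i} := by
  rw [← Finset.sum_subset (Finset.subset_univ (Finset.powersetCard 1 Finset.univ)) fun s _ hs =>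
    h s (by simpa using hs), Finset.powersetCard_one, Finset.sum_map]
  simp

end Bilin

/-! ### The Hamiltonian of a splitting -/

section Hamiltonian

variable {k : Type*} [Field k] {G : Type*} [AddCommGroup G] [Module k G] {𝒢 : Grading k G}
  {T : Type*} [AddCommGroup T] [Module k T] {𝒯 : Grading k T} {X : LInfinity 𝒢} {n : ℤ}

/-- The Hamiltonian of `X` in the coordinates given by `Φ`. -/
def splitHamiltonian (ω : ShiftedSymplectic X n) (Φ : (T × Module.Dual k T) ≃ₗ[k] G) :
    FormalMap k (T × Module.Dual k T) k :=
  pullback Φ.toLinearMap (lower ω.form X.Q)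

theorem splitHamiltonian_zero (ω : ShiftedSymplectic X n) (Φ : (T × Module.Dual k T) ≃ₗ[k] G) :
    splitHamiltonian ω Φ 0 = 0 := rfl

theorem lower_snoc (ω : G →ₗ[k] G →ₗ[k] k) (Q : FormalMap k G G) {m : ℕ} (v : Fin (m + 1) → G) :
    lower ω Q (m + 1) v = ω (Q m (fun i => v i.castSucc)) (v (Fin.last m)) := rfl

theorem splitHamiltonian_apply (ω : ShiftedSymplectic X n) (Φ : (T × Module.Dual k T) ≃ₗ[k] G)
    {m : ℕ} (e : Fin (m + 1) → T × Module.Dual k T) :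
    splitHamiltonian ω Φ (m + 1) e =
      ω.form (X.Q m fun i => Φ (e i.castSucc)) (Φ (e (Fin.last m))) := rfl

theorem ShiftedSymplectic.functionDegree_lower (ω : ShiftedSymplectic X n) :
    FunctionDegree 𝒢 (n + 1) (lower ω.form X.Q) := by
  intro m v a h ha
  cases m with
  | zero => rfl
  | succ m =>
    rw [lower_snoc]
    refine ω.degree _ _ ?_ _ (X.degree m _ _ fun i => h i.castSucc) _ (h (Fin.last m))
    rw [Fin.sum_univ_castSucc] at ha
    omega

variable [FiniteDimensional k T] {ω : ShiftedSymplectic X n} {L : LInfinity 𝒯} {f : T →ₗ[k] G}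
  {Φ : (T × Module.Dual k T) ≃ₗ[k] G}

theorem IsSplitting.gradedSymm (hΦ : IsSplitting ω 𝒯 f Φ) :
    GradedSymm (𝒯.cotangent n) (splitHamiltonian ω Φ) := ω.invariant.pullback hΦ.map_deg

theorem IsSplitting.functionDegree (hΦ : IsSplitting ω 𝒯 f Φ) :
    FunctionDegree (𝒯.cotangent n) (n + 1) (splitHamiltonian ω Φ) :=
  ω.functionDegree_lower.pullback hΦ.map_deg

/-- Strictness keeps `Q` of vectors from `L` in the image of `f`, where `ω` vanishes. -/
theorem IsSplitting.weightPart_zero (hΦ : IsSplitting ω 𝒯 f Φ) (hf : IsRegularLagrangian ω L f)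
    (m : ℕ) : weightPart 0 (splitHamiltonian ω Φ m) = 0 := by
  refine weightPart_eq_zero fun A hA e => ?_
  obtain rfl := Finset.card_eq_zero.1 hA
  cases m with
  | zero => rfl
  | succ m =>
    simp only [splitHamiltonian_apply, splitArgs, Finset.notMem_empty, if_false, hΦ.zero_section]
    rw [← hf.strict.map_bracket, hf.isotropic]

/-- The component of fibre degree one of the Hamiltonian is the vector field of `L`. -/
theorem IsSplitting.linearFunction_eq (hΦ : IsSplitting ω 𝒯 f Φ) (hf : IsRegularLagrangian ω L f)
    (m : ℕ) : linearFunction 𝒯 n L.Q m = weightPart 1 (splitHamiltonian ω Φ m) := by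
  refine (𝒯.cotangent n).multilinear_ext fun e a h => ?_
  rw [linearFunction, derivAlong_apply _ _ h,
    -- The outer function is quadratic, so `Q` absorbs all arguments but one. After passing to
    -- complements only singletons `{i}` contribute, with `i` the fibre argument.
    ← Equiv.sum_comp (compl_involutive (α := Finset (Fin m))).toPerm, weightPart_apply,
    Finset.powersetCard_one, Finset.sum_map, sum_eq_sum_powersetCard_one]
  · refine Finset.sum_congr rfl fun i _ => ?_
    simp only [Function.Involutive.coe_toPerm, compl_compl, Function.Embedding.coeFn_mk]
    rw [hΦ.gradedSymm.apply_unshuffle (splitArgs_mem h {i}) {i}ᶜ, compl_compl, sublist_singleton]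
    congr 1
    rw [List.map_singleton, List.map_singleton, splitHamiltonian, evalList_pullback,
      List.map_append, List.map_singleton, evalList_lower_append]
    have e₁ : ((sublist {i}ᶜ).map (splitArgs {i} e)).map Φ.toLinearMap =
        ((sublist {i}ᶜ).map fun j => (e j).1).map f := by
      rw [List.map_map, List.map_map]
      refine List.map_congr_left fun j hj => ?_
      have hj : j ≠ i := by simpa [mem_sublist] using hj
      simp [splitArgs, hj, hΦ.zero_section]
    rw [e₁, ← hf.strict.map_evalList, ← hΦ.zero_section]
    simp only [LinearEquiv.coe_coe, hΦ.symplectic]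
    change ofBilin _ 2 _ = _
    rw [ofBilin_two]
    have e₂ : evalList (fun m => (LinearMap.inl k T (Module.Dual k T)).compMultilinearMap
        ((L.Q m).compLinearMap fun _ => LinearMap.fst k T (Module.Dual k T)))
          ((sublist {i}ᶜ).map e) = (evalList L.Q ((sublist {i}ᶜ).map fun j => (e j).1), 0) := by
      refine Prod.ext ?_ rfl
      exact (evalList_pullback (LinearMap.fst k T (Module.Dual k T)) L.Q _).trans
        (by rw [List.map_map]; rfl)
    simp [e₂, splitArgs]
  · intro s hs
    simp only [Function.Involutive.coe_toPerm, compl_compl]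
    rw [evalList, ofBilin_of_ne]
    · simp
    · simpa [length_sublist] using hs

theorem IsSplitting.canonicalForm_injective (hΦ : IsSplitting ω 𝒯 f Φ)
    {e e' : T × Module.Dual k T} (h : ∀ u, canonicalForm 𝒯 n e u = canonicalForm 𝒯 n e' u) :
    e = e' := by
  refine Φ.injective (ω.form_injective fun z => ?_)
  rw [← Φ.apply_symm_apply z, hΦ.symplectic, hΦ.symplectic, h]

theorem canonicalForm_hamiltonian (F : FormalMap k (T × Module.Dual k T) k) {m : ℕ}
    (e : Fin m → T × Module.Dual k T) (u : T × Module.Dual k T) :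
    canonicalForm 𝒯 n (hamiltonian 𝒯 n F m e) u = F (m + 1) (Fin.snoc e u) := by
  rw [hamiltonian, LinearMap.compMultilinearMap_apply, canonicalForm_sharp]
  rfl

/-- Nondegeneracy makes vector fields and their Hamiltonians determine each other. The constant term
is left out, being invisible to the vector field. -/
theorem IsSplitting.strict_iff (hΦ : IsSplitting ω 𝒯 f Φ)
    (F : FormalMap k (T × Module.Dual k T) k) :
    IsStrictMap (𝒯.cotangent n) 𝒢 (hamiltonian 𝒯 n F) X.Q Φ.toLinearMap ↔
      ∀ m, F (m + 1) = splitHamiltonian ω Φ (m + 1) := by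
  constructor
  · intro h m
    ext e
    have := canonicalForm_hamiltonian (𝒯 := 𝒯) (n := n) F (Fin.init e) (e (Fin.last m))
    rw [Fin.snoc_init_self, ← hΦ.symplectic] at this
    rw [← this, splitHamiltonian_apply]
    exact congrArg (fun z => ω.form z _) (h.map_bracket m _)
  · intro h
    refine ⟨hΦ.map_deg, fun m e => ω.form_injective fun z => ?_⟩
    obtain ⟨u, rfl⟩ := Φ.surjective z
    rw [LinearEquiv.coe_coe, hΦ.symplectic, canonicalForm_hamiltonian, h, splitHamiltonian_apply]
    simp

/-- The Hamiltonian of a splitting satisfies the classical master equation. -/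
theorem IsSplitting.schouten_self (hΦ : IsSplitting ω 𝒯 f Φ) :
    schouten 𝒯 n (splitHamiltonian ω Φ) (splitHamiltonian ω Φ) = 0 := by
  have h := (hΦ.strict_iff (splitHamiltonian ω Φ)).2 fun _ => rfl
  change derivAlong _ _ (pullback Φ.toLinearMap (lower ω.form X.Q)) = 0
  rw [derivAlong_pullback h, ω.derivAlong_lower]
  rfl

theorem IsPolyvector.apply_zero {d : ℤ} {P : FormalMap k (T × Module.Dual k T) k}
    (hP : IsPolyvector 𝒯 n d P) : P 0 = 0 := by
  rw [← sum_weightPart (P 0), zero_add, Finset.sum_range_one, hP.weight_zero]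

/-- Fixes the constant term, which strictness of `Φ` cannot detect. -/
theorem IsSplitting.totalHamiltonian_zero (hΦ : IsSplitting ω 𝒯 f Φ)
    (hf : IsRegularLagrangian ω L f) {d : ℤ} {P : FormalMap k (T × Module.Dual k T) k}
    (hP : IsPolyvector 𝒯 n d P) : totalHamiltonian L n P 0 = 0 := by
  rw [totalHamiltonian, hΦ.linearFunction_eq hf, hP.apply_zero, splitHamiltonian_zero,
    weightPart_eq_mixPart, mixPart_of_lt _ _ zero_lt_one, add_zero]

theorem IsSplitting.strict_twistedCotangent_iff (hΦ : IsSplitting ω 𝒯 f Φ)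
    (hf : IsRegularLagrangian ω L f) {d : ℤ} {P : FormalMap k (T × Module.Dual k T) k}
    (hP : IsPolyvector 𝒯 n d P) :
    IsStrictMap (𝒯.cotangent n) 𝒢 (twistedCotangent L n P) X.Q Φ.toLinearMap ↔
      totalHamiltonian L n P = splitHamiltonian ω Φ := by
  rw [twistedCotangent, hΦ.strict_iff]
  constructor
  · intro h
    funext m
    cases m with
    | zero => rw [hΦ.totalHamiltonian_zero hf hP, splitHamiltonian_zero]
    | succ m => exact h m
  · intro h m
    rw [h]

theorem IsSplitting.isInducedPoisson (hΦ : IsSplitting ω 𝒯 f Φ) (hf : IsRegularLagrangian ω L f)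
    {P : FormalMap k (T × Module.Dual k T) k} (hP : IsPolyvector 𝒯 n (n + 1) P)
    (h : totalHamiltonian L n P = splitHamiltonian ω Φ) : IsInducedPoisson ω L f Φ P where
  splitting := hΦ
  poisson := ⟨hP, fun m => by rw [h, hΦ.schouten_self]; rfl⟩
  strict := (hΦ.strict_twistedCotangent_iff hf hP).2 h

theorem IsInducedPoisson.totalHamiltonian_eq {P : FormalMap k (T × Module.Dual k T) k}
    (h : IsInducedPoisson ω L f Φ P) (hf : IsRegularLagrangian ω L f) :
    totalHamiltonian L n P = splitHamiltonian ω Φ :=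
  (h.splitting.strict_twistedCotangent_iff hf h.poisson.polyvector).1 h.strict

/-- The homotopy Poisson structure of a splitting: the components of fibre degree at least two of
the Hamiltonian. -/
def splitPoisson (ω : ShiftedSymplectic X n) (Φ : (T × Module.Dual k T) ≃ₗ[k] G) :
    FormalMap k (T × Module.Dual k T) k :=
  fun m => splitHamiltonian ω Φ m - weightPart 1 (splitHamiltonian ω Φ m)

theorem GradedSymm.sub {V W : Type*} [AddCommGroup V] [Module k V] [AddCommGroup W] [Module k W]
    {𝒱 : Grading k V} {φ ψ : FormalMap k V W} (hφ : GradedSymm 𝒱 φ) (hψ : GradedSymm 𝒱 ψ) :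
    GradedSymm 𝒱 fun m => φ m - ψ m := fun m v i j hij a b hi hj => by
  rw [sub_apply, hφ m v i j hij a b hi hj, hψ m v i j hij a b hi hj, ← smul_sub]
  rfl

theorem FunctionDegree.sub {V : Type*} [AddCommGroup V] [Module k V]
    {𝒱 : Grading k V} {d : ℤ} {φ ψ : FormalMap k V k} (hφ : FunctionDegree 𝒱 d φ)
    (hψ : FunctionDegree 𝒱 d ψ) : FunctionDegree 𝒱 d fun m => φ m - ψ m := fun m v a h ha => by
  rw [sub_apply, hφ m v a h ha, hψ m v a h ha, sub_zero]

theorem IsSplitting.isPolyvector_splitPoisson (hΦ : IsSplitting ω 𝒯 f Φ)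
    (hf : IsRegularLagrangian ω L f) : IsPolyvector 𝒯 n (n + 1) (splitPoisson ω Φ) where
  symm := hΦ.gradedSymm.sub (hΦ.gradedSymm.weightPart 1)
  degree := hΦ.functionDegree.sub (hΦ.functionDegree.weightPart 1)
  weight_zero m := by
    rw [splitPoisson, weightPart_eq_mixPart, mixPart_sub, ← weightPart_eq_mixPart,
      ← weightPart_eq_mixPart, weightPart_weightPart, hΦ.weightPart_zero hf]
    simp
  weight_one m := by
    rw [splitPoisson, weightPart_eq_mixPart, mixPart_sub, ← weightPart_eq_mixPart,
      ← weightPart_eq_mixPart, weightPart_weightPart]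
    simp

theorem IsSplitting.totalHamiltonian_splitPoisson (hΦ : IsSplitting ω 𝒯 f Φ)
    (hf : IsRegularLagrangian ω L f) :
    totalHamiltonian L n (splitPoisson ω Φ) = splitHamiltonian ω Φ := by
  funext m
  rw [totalHamiltonian, hΦ.linearFunction_eq hf, splitPoisson, add_sub_cancel]

theorem totalHamiltonian_injective {P P' : FormalMap k (T × Module.Dual k T) k}
    (h : totalHamiltonian L n P = totalHamiltonian L n P') : P = P' :=
  funext fun m => add_left_cancel (congrFun h m)

/-- The linearization of `X` along `L` is the shifted cotangent bundle. -/
theorem IsSplitting.twistedCotangent_zero_apply (hΦ : IsSplitting ω 𝒯 f Φ)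
    (hf : IsRegularLagrangian ω L f) {m : ℕ} (v : Fin m → T) (w : Fin m → G) :
    twistedCotangent L n 0 m (fun i => (v i, ω.form (w i) ∘ₗ f)) =
      (L.Q m v, ω.form (∑ i, X.Q m (Function.update (fun j => f (v j)) i (w i))) ∘ₗ f) := by
  refine hΦ.canonicalForm_injective fun u => ?_
  obtain ⟨y, η⟩ := u
  rw [twistedCotangent, canonicalForm_hamiltonian]
  have h₀ : totalHamiltonian L n 0 (m + 1) = weightPart 1 (splitHamiltonian ω Φ (m + 1)) := by
    rw [totalHamiltonian, hΦ.linearFunction_eq hf, Pi.zero_apply, add_zero]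
  -- In fibre degree one exactly one slot carries a covector. If it is the last slot, the term gives
  -- the base component `L.Q m v`; the other slots give the fibre component.
  rw [h₀, weightPart_apply, Finset.powersetCard_one, Finset.sum_map, Fin.sum_univ_castSucc]
  simp only [splitHamiltonian_apply, Function.Embedding.coeFn_mk]
  have h₁ : ω.form (X.Q m fun i => Φ (splitArgs {Fin.last m}
      (Fin.snoc (fun i => (v i, ω.form (w i) ∘ₗ f)) (y, η) : Fin (m + 1) → T × Module.Dual k T)
        i.castSucc)) (Φ (splitArgs {Fin.last m}
      (Fin.snoc (fun i => (v i, ω.form (w i) ∘ₗ f)) (y, η) : Fin (m + 1) → T × Module.Dual k T)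
        (Fin.last m))) = canonicalForm 𝒯 n (L.Q m v, 0) (0, η) := by
    rw [← hΦ.symplectic, hΦ.zero_section, hf.strict.map_bracket]
    simp [splitArgs, hΦ.zero_section, (Fin.castSucc_lt_last _).ne]
  have h₂ : ∀ i : Fin m, ω.form (X.Q m fun j => Φ (splitArgs {i.castSucc}
      (Fin.snoc (fun i => (v i, ω.form (w i) ∘ₗ f)) (y, η) : Fin (m + 1) → T × Module.Dual k T)
        j.castSucc)) (Φ (splitArgs {i.castSucc}
      (Fin.snoc (fun i => (v i, ω.form (w i) ∘ₗ f)) (y, η) : Fin (m + 1) → T × Module.Dual k T)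
        (Fin.last m))) =
      ω.form (X.Q m (Function.update (fun j => f (v j)) i (w i))) (f y) := by
    intro i
    -- The splitting recovers `w i` only up to a vector `f b`, whose contribution vanishes because
    -- `f` is strict and isotropic.
    obtain ⟨b, hb⟩ := (hf.restrictForm_eq_zero (Φ (0, ω.form (w i) ∘ₗ f) - w i)).1 (by
      rw [map_sub, hΦ.restrictForm_inr]
      exact sub_self _)
    have e₁ : (fun j => Φ (splitArgs {i.castSucc}
        (Fin.snoc (fun i => (v i, ω.form (w i) ∘ₗ f)) (y, η) : Fin (m + 1) → T × Module.Dual k T)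
          j.castSucc)) = Function.update (fun j => f (v j)) i (f b + w i) := by
      ext j
      by_cases hj : j = i
      · subst hj
        simp [splitArgs, hb]
      · simp [splitArgs, hj, hΦ.zero_section]
    have e₂ : Function.update (fun j => f (v j)) i (f b) =
        fun j => f (Function.update v i b j) := by
      ext j
      by_cases hj : j = i
      · subst hj; simp
      · simp [hj]
    rw [e₁, MultilinearMap.map_update_add, e₂, ← hf.strict.map_bracket]
    simp [splitArgs, hΦ.zero_section, (Fin.castSucc_lt_last _).ne', hf.isotropic]
  rw [h₁, Finset.sum_congr rfl fun i _ => h₂ i]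
  simp [canonicalForm, sub_eq_add_neg]

end Hamiltonian

/-! ### Deformation to the normal cone -/

section Rescale

variable {k : Type*} [Field k] {G : Type*} [AddCommGroup G] [Module k G] {𝒢 : Grading k G}
  {T : Type*} [AddCommGroup T] [Module k T] {𝒯 : Grading k T}
  {X : LInfinity 𝒢} {n : ℤ} {ω : ShiftedSymplectic X n} {L : LInfinity 𝒯} {f : T →ₗ[k] G}
  {Φ : (T × Module.Dual k T) ≃ₗ[k] G} {P : FormalMap k (T × Module.Dual k T) k}

theorem weightPart_rescale (c : k) (P : FormalMap k (T × Module.Dual k T) k) (i m : ℕ) :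
    weightPart i (rescale c P m) = c ^ (i - 1) • weightPart i (P m) := by
  rw [rescale, weightPart_eq_mixPart, mixPart_sum]
  simp only [mixPart_smul, ← weightPart_eq_mixPart, weightPart_weightPart, smul_ite, smul_zero]
  rw [Finset.sum_ite_eq]
  split_ifs with h
  · rfl
  · rw [weightPart_eq_mixPart, mixPart_of_lt _ _ (by simpa using h), smul_zero]

theorem rescale_one (P : FormalMap k (T × Module.Dual k T) k) : rescale 1 P = P := by
  funext m
  simp only [rescale, one_pow, one_smul, sum_weightPart]

/-- The symplectic structure `c⁻¹ ω`. -/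
def ShiftedSymplectic.invScale (ω : ShiftedSymplectic X n) (c : k) (hc : c ≠ 0) :
    ShiftedSymplectic X n where
  form := c⁻¹ • ω.form
  degree a b h x hx y hy := by simp [ω.degree a b h x hx y hy]
  antisymm a b x hx y hy := by
    rw [LinearMap.smul_apply, LinearMap.smul_apply, LinearMap.smul_apply, LinearMap.smul_apply,
      ω.antisymm a b x hx y hy, smul_neg, smul_comm]
  nondegenerate :=
    (LinearEquiv.smulOfNeZero k (Module.Dual k G) c⁻¹ (inv_ne_zero hc)).bijective.comp
      ω.nondegenerate
  invariant m v i j hij a b hi hj := by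
    have h := ω.invariant m v i j hij a b hi hj
    cases m with
    | zero => exact i.elim0
    | succ m =>
      rw [lower_snoc, lower_snoc] at h ⊢
      rw [LinearMap.smul_apply, LinearMap.smul_apply, h, LinearMap.smul_apply,
        LinearMap.smul_apply, smul_comm]

theorem IsRegularLagrangian.invScale (hf : IsRegularLagrangian ω L f) (c : k) (hc : c ≠ 0) :
    IsRegularLagrangian (ω.invScale c hc) L f where
  strict := hf.strict
  injective := hf.injective
  isotropic x y := by simp [ShiftedSymplectic.invScale, hf.isotropic]
  coisotropic y h := hf.coisotropic y fun x => by
    simpa [ShiftedSymplectic.invScale, hc] using h x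

variable [FiniteDimensional k T]

theorem IsPolyvector.rescale {d : ℤ} (hP : IsPolyvector 𝒯 n d P) (c : k) :
    IsPolyvector 𝒯 n d (rescale c P) where
  symm m v i j hij a b hi hj := by
    simp only [FormalModuli.rescale, sum_apply, smul_apply, Finset.smul_sum]
    refine Finset.sum_congr rfl fun r _ => ?_
    rw [hP.symm.weightPart r m v i j hij a b hi hj, smul_comm]
  degree m v a h ha := by
    simp only [FormalModuli.rescale, sum_apply, smul_apply]
    exact Finset.sum_eq_zero fun r _ => by rw [hP.degree.weightPart r m v a h ha, smul_zero]
  weight_zero m := by rw [weightPart_rescale, hP.weight_zero, smul_zero]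
  weight_one m := by rw [weightPart_rescale, hP.weight_one, smul_zero]

theorem IsPolyvector.rescale_zero {d : ℤ} (hP : IsPolyvector 𝒯 n d P) :
    FormalModuli.rescale 0 P = 0 := by
  funext m
  refine Finset.sum_eq_zero fun j _ => ?_
  -- In fibre degrees 0 and 1 the coefficient `0 ^ (j - 1)` is `1` by truncated subtraction; there
  -- the components of `P` themselves vanish.
  match j with
  | 0 => rw [hP.weight_zero, smul_zero]
  | 1 => rw [hP.weight_one, smul_zero]
  | j + 2 => simp

/-- Dilation of the fibres as a linear isomorphism. -/
def dilationEquiv (k T : Type*) [Field k] [AddCommGroup T] [Module k T] (c : k) (hc : c ≠ 0) :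
    (T × Module.Dual k T) ≃ₗ[k] (T × Module.Dual k T) :=
  (LinearEquiv.refl k T).prodCongr (LinearEquiv.smulOfNeZero k (Module.Dual k T) c hc)

/-- Both terms of the canonical form are linear in the fibre, so dilation multiplies it by `c`,
which `c⁻¹ ω` compensates. -/
theorem IsSplitting.dilation (hΦ : IsSplitting ω 𝒯 f Φ) (c : k) (hc : c ≠ 0) :
    IsSplitting (ω.invScale c hc) 𝒯 f ((dilationEquiv k T c hc).trans Φ) where
  map_deg i e he := hΦ.map_deg i _ ⟨he.1, Submodule.smul_mem _ c he.2⟩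
  zero_section x := by
    rw [← hΦ.zero_section]
    simp [dilationEquiv]
  symplectic e e' := by
    change c⁻¹ • ω.form (Φ (e.1, c • e.2)) (Φ (e'.1, c • e'.2)) = _
    rw [hΦ.symplectic]
    simp only [canonicalForm, LinearMap.mk₂_apply, LinearMap.smul_apply, smul_eq_mul]
    field_simp

/-- The exponent `j - 1` leaves fibre degree one unscaled, so the term `Q_𝔩` can be absorbed into
one uniform sum. -/
theorem IsSplitting.totalHamiltonian_rescale (hΦ : IsSplitting ω 𝒯 f Φ)
    (hf : IsRegularLagrangian ω L f) (h : totalHamiltonian L n P = splitHamiltonian ω Φ) (c : k)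
    (m : ℕ) : totalHamiltonian L n (rescale c P) m =
      ∑ j ∈ Finset.range (m + 1), c ^ (j - 1) • weightPart j (splitHamiltonian ω Φ m) := by
  have hP : P m = splitHamiltonian ω Φ m - weightPart 1 (splitHamiltonian ω Φ m) := by
    rw [← h, eq_sub_iff_add_eq, h, ← hΦ.linearFunction_eq hf, add_comm, ← h]
    rfl
  have h₁ : ∑ j ∈ Finset.range (m + 1),
      c ^ (j - 1) • weightPart j (weightPart 1 (splitHamiltonian ω Φ m)) =
        weightPart 1 (splitHamiltonian ω Φ m) := by
    simp only [weightPart_weightPart, smul_ite, smul_zero]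
    rw [Finset.sum_ite_eq']
    split_ifs with h
    · simp
    · rw [weightPart_eq_mixPart, mixPart_of_lt _ _ (by simpa using h)]
  rw [totalHamiltonian, hΦ.linearFunction_eq hf, rescale, hP]
  simp only [weightPart_eq_mixPart, mixPart_sub, smul_sub, Finset.sum_sub_distrib] at h₁ ⊢
  rw [h₁, add_sub_cancel]

theorem IsSplitting.splitHamiltonian_dilation (hΦ : IsSplitting ω 𝒯 f Φ)
    (hf : IsRegularLagrangian ω L f) (c : k) (hc : c ≠ 0) (m : ℕ) :
    splitHamiltonian (ω.invScale c hc) ((dilationEquiv k T c hc).trans Φ) m =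
      ∑ j ∈ Finset.range (m + 1), c ^ (j - 1) • weightPart j (splitHamiltonian ω Φ m) := by
  have h₁ : splitHamiltonian (ω.invScale c hc) ((dilationEquiv k T c hc).trans Φ) m =
      c⁻¹ • (splitHamiltonian ω Φ m).compLinearMap fun _ => FormalModuli.dilation k T c := by
    cases m with
    | zero => ext; simp [splitHamiltonian_zero]
    | succ m => rfl
  rw [h₁, compLinearMap_dilation, Finset.smul_sum]
  refine Finset.sum_congr rfl fun j _ => ?_
  -- `c⁻¹ * c ^ j = c ^ (j - 1)` fails for `j = 0` with truncated subtraction, but that component is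
  -- zero.
  cases j with
  | zero => simp [hΦ.weightPart_zero hf]
  | succ j => rw [smul_smul, pow_succ', inv_mul_cancel_left₀ hc, Nat.add_sub_cancel]

theorem IsInducedPoisson.rescale (h : IsInducedPoisson ω L f Φ P) (hf : IsRegularLagrangian ω L f)
    (c : k) (hc : c ≠ 0) :
    IsInducedPoisson (ω.invScale c hc) L f ((dilationEquiv k T c hc).trans Φ)
      (FormalModuli.rescale c P) := by
  refine (h.splitting.dilation c hc).isInducedPoisson (hf.invScale c hc)
    (h.poisson.polyvector.rescale c) (funext fun m => ?_)
  rw [h.splitting.totalHamiltonian_rescale hf (h.totalHamiltonian_eq hf),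
    h.splitting.splitHamiltonian_dilation hf]

theorem evalList_cons_linear {V W : Type*} [AddCommGroup V] [Module k V] [AddCommGroup W]
    [Module k W] (φ : FormalMap k V W) (l : List V) {ι : Type*} (S : Finset ι) (c : ι → k)
    (x : ι → V) :
    evalList φ ((∑ i ∈ S, c i • x i) :: l) = ∑ i ∈ S, c i • evalList φ (x i :: l) := by
  have h : ∀ y, evalList φ (y :: l) = (φ (l.length + 1)).curryLeft y l.get := fun y =>
    evalList_eq φ (by simp) fun i => by
      refine Fin.cases ?_ (fun i => ?_) i <;> simp
  simp only [h, map_sum, map_smul, sum_apply, smul_apply]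

/-- The self-bracket of a polynomial family of functions is polynomial in the parameter. -/
theorem exists_polynomial_schouten (𝒯 : Grading k T) (n : ℤ)
    (U : ℕ → FormalMap k (T × Module.Dual k T) k) {F : k → FormalMap k (T × Module.Dual k T) k}
    (hF : ∀ c m, F c m = ∑ j ∈ Finset.range (m + 1), c ^ (j - 1) • U j m) (m : ℕ)
    (e : Fin m → T × Module.Dual k T) :
    ∃ p : Polynomial k, ∀ c, schouten 𝒯 n (F c) (F c) m e = p.eval c := by
  have h₁ : ∀ c l, evalList (F c) l =
      ∑ j ∈ Finset.range (l.length + 1), c ^ (j - 1) * evalList (U j) l := fun c l => by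
    simp [evalList, hF]
  -- The range is one longer than in `h₁` because `hamiltonian` uses the Taylor coefficient with one
  -- more argument.
  have h₂ : ∀ c l, evalList (hamiltonian 𝒯 n (F c)) l =
      ∑ j ∈ Finset.range (l.length + 2), c ^ (j - 1) • evalList (hamiltonian 𝒯 n (U j)) l :=
    fun c l => by
      simp only [evalList, hamiltonian, hF, LinearMap.compMultilinearMap_apply]
      rw [← Finset.sum_congr rfl fun j _ => map_smul (sharp 𝒯 n) _ _, ← map_sum]
      congr 1
      ext u <;> simp [MultilinearMap.curryRight_apply]
  choose p hp using fun (q : Fin m → Bool) (s : Finset (Fin m)) =>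
    show ∃ p : Polynomial k, ∀ c, (koszulSign s q •
        (insertOne (F c) (hamiltonian 𝒯 n (F c)) s).compLinearMap
          fun i => (𝒯.cotangent n).parityProj (q i)) e = p.eval c from by
      simp only [smul_apply, MultilinearMap.compLinearMap_apply, insertOne_apply]
      generalize (sublist s).map (fun i => (𝒯.cotangent n).parityProj (q i) (e i)) = l
      generalize (sublist sᶜ).map (fun i => (𝒯.cotangent n).parityProj (q i) (e i)) = l'
      refine ⟨koszulSign s q • ∑ i ∈ Finset.range (l.length + 2), Polynomial.X ^ (i - 1) *
        ∑ j ∈ Finset.range (l'.length + 1 + 1), Polynomial.X ^ (j - 1) *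
          Polynomial.C (evalList (U j) (evalList (hamiltonian 𝒯 n (U i)) l :: l')), fun c => ?_⟩
      rw [h₂, evalList_cons_linear]
      simp only [h₁, List.length_cons, Polynomial.eval_smul, Polynomial.eval_finsetSum,
        Polynomial.eval_mul, Polynomial.eval_pow, Polynomial.eval_X, Polynomial.eval_C, smul_eq_mul]
  refine ⟨∑ q, ∑ s, p q s, fun c => ?_⟩
  simp only [schouten, derivAlong, sum_apply, hp, Polynomial.eval_finsetSum]

/-- For `c ≠ 0` the dilated splitting proves it; a polynomial over an infinite field that vanishes
away from `0` is zero, which settles `c = 0`. -/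
theorem IsInducedPoisson.isHomotopyPoisson_rescale [CharZero k] (h : IsInducedPoisson ω L f Φ P)
    (hf : IsRegularLagrangian ω L f) (c : k) :
    IsHomotopyPoisson L n (FormalModuli.rescale c P) := by
  refine ⟨h.poisson.polyvector.rescale c, fun m => ?_⟩
  ext e
  obtain ⟨p, hp⟩ := exists_polynomial_schouten 𝒯 n
    (fun j m => weightPart j (splitHamiltonian ω Φ m))
    (F := fun c => totalHamiltonian L n (FormalModuli.rescale c P))
    (fun c m => h.splitting.totalHamiltonian_rescale hf (h.totalHamiltonian_eq hf) c m) m e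
  -- The factor `X` makes the polynomial vanish at `c = 0` as well, so that it vanishes everywhere.
  have hp0 : Polynomial.X * p = 0 := Polynomial.funext fun c => by
    by_cases hc : c = 0
    · simp [hc]
    · rw [Polynomial.eval_mul, ← hp, (h.rescale hf c hc).poisson.maurerCartan]
      simp
  have hp0 : p = 0 := (mul_eq_zero.1 hp0).resolve_left Polynomial.X_ne_zero
  rw [hp, hp0]
  simp

end Rescale

/-! ### Dependence on the splitting -/

section Gauge

variable {k : Type*} [Field k] {G : Type*} [AddCommGroup G] [Module k G] {𝒢 : Grading k G}
  {T : Type*} [AddCommGroup T] [Module k T] [FiniteDimensional k T] {𝒯 : Grading k T}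
  {X : LInfinity 𝒢} {n : ℤ} {ω : ShiftedSymplectic X n} {L : LInfinity 𝒯} {f : T →ₗ[k] G}
  {Φ Φ' : (T × Module.Dual k T) ≃ₗ[k] G} {P P' : FormalMap k (T × Module.Dual k T) k}

/-- The bracket with a quadratic function acts by its linear Hamiltonian vector field. -/
theorem schouten_ofBilin {N : (T × Module.Dual k T) →ₗ[k] (T × Module.Dual k T)}
    (hN : ∀ i, ∀ e ∈ (𝒯.cotangent n).deg i, N e ∈ (𝒯.cotangent n).deg i)
    (hinj : ∀ e e', (∀ u, canonicalForm 𝒯 n e u = canonicalForm 𝒯 n e' u) → e = e')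
    {F : FormalMap k (T × Module.Dual k T) k} (hF : GradedSymm (𝒯.cotangent n) F) (m : ℕ) :
    schouten 𝒯 n (ofBilin (canonicalForm 𝒯 n ∘ₗ N)) F m = mixPart N LinearMap.id 1 (F m) := by
  refine (𝒯.cotangent n).multilinear_ext fun e a h => ?_
  rw [schouten, derivAlong_apply _ _ h, mixPart_one_apply, sum_eq_sum_powersetCard_one]
  · refine Finset.sum_congr rfl fun i _ => ?_
    have hw : ∀ j, (if j = i then N (e j) else (LinearMap.id : _ →ₗ[k] _) (e j)) ∈
        (𝒯.cotangent n).deg (a j) := fun j => by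
      split_ifs
      exacts [hN _ _ (h j), h j]
    rw [hF.apply_unshuffle hw {i}, sublist_singleton]
    congr 1
    have e₁ : evalList (hamiltonian 𝒯 n (ofBilin (canonicalForm 𝒯 n ∘ₗ N))) [e i] = N (e i) :=
      hinj _ _ fun u => by
        rw [evalList, canonicalForm_hamiltonian]
        rfl
    have e₂ : (sublist {i}ᶜ).map (fun j => if j = i then N (e j) else (LinearMap.id : _ →ₗ[k] _) (e j))
        = (sublist {i}ᶜ).map e := by
      refine List.map_congr_left fun j hj => ?_
      have hj : j ≠ i := by simpa [mem_sublist] using hj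
      simp [hj]
    rw [e₂]
    simp [e₁]
  · intro s hs
    have : evalList (hamiltonian 𝒯 n (ofBilin (canonicalForm 𝒯 n ∘ₗ N))) ((sublist s).map e) = 0 :=
      hinj _ _ fun u => by
        rw [evalList, canonicalForm_hamiltonian, ofBilin_of_ne]
        · simp
        · simpa [length_sublist] using hs
    rw [this]
    have h0 := evalList_cons_linear F ((sublist sᶜ).map e) (∅ : Finset ℕ) 0 0
    simp only [Finset.sum_empty] at h0
    rw [h0, smul_zero]

/-- `N = Φ⁻¹ Φ' - 1` kills `T` since the splittings agree there, and lands in `T` since they have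
the same `restrictForm` on covectors. The gauge parameter is the quadratic function `ω_can (N -,
-)`, and its exponential series is the expansion of the pullback along `1 + N`. -/
theorem IsSplitting.gaugeEquivalent [CharZero k] (hΦ : IsSplitting ω 𝒯 f Φ)
    (hΦ' : IsSplitting ω 𝒯 f Φ') (hf : IsRegularLagrangian ω L f)
    (h : totalHamiltonian L n P = splitHamiltonian ω Φ)
    (h' : totalHamiltonian L n P' = splitHamiltonian ω Φ') : GaugeEquivalent L n P P' := by
  let N : (T × Module.Dual k T) →ₗ[k] (T × Module.Dual k T) :=
    Φ.symm.toLinearMap ∘ₗ Φ'.toLinearMap - LinearMap.id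
  have hΦN : ∀ e, Φ (N e) = Φ' e - Φ e := fun e => by simp [N]
  have hN_inl : ∀ x, N (x, 0) = 0 := fun x => Φ.injective (by
    rw [hΦN, hΦ.zero_section, hΦ'.zero_section, sub_self, map_zero])
  have hN_eq : ∀ e, N e = N (0, e.2) := fun e => by
    have : e = (e.1, 0) + (0, e.2) := by simp
    rw [this, map_add, hN_inl, zero_add]
    simp
  have hN_range : ∀ e, ∃ x, N e = (x, 0) := fun e => by
    obtain ⟨x, hx⟩ := (hf.restrictForm_eq_zero (Φ (N (0, e.2)))).1 (by
      rw [hΦN, map_sub, hΦ.restrictForm_inr, hΦ'.restrictForm_inr, sub_self])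
    exact ⟨x, by rw [hN_eq]; exact Φ.injective (by rw [hΦ.zero_section, hx])⟩
  have hNN : ∀ e, N (N e) = 0 := fun e => by
    obtain ⟨x, hx⟩ := hN_range e
    rw [hx, hN_inl]
  have hNd : ∀ i, ∀ e ∈ (𝒯.cotangent n).deg i, N e ∈ (𝒯.cotangent n).deg i := fun i e he =>
    Grading.mem_of_map_mem (f := Φ.toLinearMap) hΦ.map_deg Φ.injective (by
      rw [LinearEquiv.coe_coe, hΦN]
      exact Submodule.sub_mem _ (hΦ'.map_deg i e he) (hΦ.map_deg i e he))
  have hiso : ∀ (e : T × Module.Dual k T) (x : T), canonicalForm 𝒯 n (N e) (x, 0) = 0 :=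
    fun e x => by
      obtain ⟨y, hy⟩ := hN_range e
      simp [hy, canonicalForm]
  -- `1 + N` preserves the canonical form, and the term quadratic in `N` vanishes because `T` is
  -- isotropic.
  have hskew : ∀ e e', canonicalForm 𝒯 n (N e) e' = -canonicalForm 𝒯 n e (N e') := fun e e' => by
    have h₁ : ∀ e, Φ' e = Φ (e + N e) := fun e => by rw [map_add, hΦN, add_sub_cancel]
    have h₂ := hΦ'.symplectic e e'
    rw [h₁, h₁, hΦ.symplectic] at h₂
    obtain ⟨x, hx⟩ := hN_range e'
    have h₃ : canonicalForm 𝒯 n (N e) (N e') = 0 := by rw [hx, hiso]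
    simp only [map_add, LinearMap.add_apply, h₃] at h₂
    linear_combination h₂
  let β := canonicalForm 𝒯 n ∘ₗ N
  have hβ : IsPolyvector 𝒯 n n (ofBilin β) := by
    refine ⟨?_, ?_, ?_, ?_⟩
    · intro m v i j hij a b hi hj
      by_cases hm : m = 2
      · subst hm
        obtain rfl : i = 0 := by ext; simp; omega
        obtain rfl : j = 1 := by ext; simp; omega
        rw [ofBilin_two, ofBilin_two]
        change canonicalForm 𝒯 n (N (v 1)) (v 0) = _ • canonicalForm 𝒯 n (N (v 0)) (v 1)
        rw [hskew, ← hΦ.symplectic (v 1), ω.antisymm b a _ (hΦ.map_deg _ _ hj) _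
          (hΦ.map_deg _ _ (hNd _ _ hi)), hΦ.symplectic, neg_neg, mul_comm]
      · rw [ofBilin_of_ne _ hm]
        simp
    · intro m v a hv ha
      by_cases hm : m = 2
      · subst hm
        rw [ofBilin_two]
        change canonicalForm 𝒯 n (N (v 0)) (v 1) = _
        rw [← hΦ.symplectic]
        refine ω.degree (a 0) (a 1) ?_ _ (hΦ.map_deg _ _ (hNd _ _ (hv 0))) _ (hΦ.map_deg _ _ (hv 1))
        rw [Fin.sum_univ_two] at ha
        omega
      · rw [ofBilin_of_ne _ hm]
        rfl
    · intro m
      refine weightPart_eq_zero fun A hA e => ?_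
      by_cases hm : m = 2
      · subst hm
        obtain rfl := Finset.card_eq_zero.1 hA
        rw [ofBilin_two]
        exact hiso _ _
      · rw [ofBilin_of_ne _ hm]
        rfl
    · intro m
      refine weightPart_eq_zero fun A hA e => ?_
      by_cases hm : m = 2
      · subst hm
        obtain ⟨i, rfl⟩ := Finset.card_eq_one.1 hA
        rw [ofBilin_two]
        change canonicalForm 𝒯 n (N _) _ = 0
        by_cases hi : i = 0
        · subst hi
          simp [splitArgs, hiso]
        · have : (0 : Fin 2) ≠ i := Ne.symm hi
          simp [splitArgs, this, hN_inl]
      · rw [ofBilin_of_ne _ hm]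
        rfl
  refine ⟨ofBilin β, hβ, fun m => ?_⟩
  have hiter : ∀ r, (schouten 𝒯 n (ofBilin β))^[r] (splitHamiltonian ω Φ) = fun m =>
      (r.factorial : k) • mixPart N LinearMap.id r (splitHamiltonian ω Φ m) := by
    intro r
    induction r with
    | zero =>
      funext m
      ext e
      simp [mixPart_apply]
    | succ r ih =>
      rw [Function.iterate_succ_apply', ih]
      have hs : GradedSymm (𝒯.cotangent n) fun m =>
          (r.factorial : k) • mixPart N LinearMap.id r (splitHamiltonian ω Φ m) :=
        fun m v i j hij a b hi hj => by
          rw [smul_apply, smul_apply, hΦ.gradedSymm.mixPart hNd (fun _ _ hx => hx) r m v i j hij a b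
            hi hj, smul_comm]
      funext m
      rw [schouten_ofBilin hNd (fun _ _ => hΦ.canonicalForm_injective) hs, mixPart_smul,
        mixPart_one_mixPart hNN, smul_smul, ← Nat.cast_mul, mul_comm, ← Nat.factorial_succ]
  have hΦ'eq : splitHamiltonian ω Φ' m =
      (splitHamiltonian ω Φ m).compLinearMap fun _ => LinearMap.id + (1 : k) • N := by
    ext e
    change lower ω.form X.Q m (fun i => Φ' (e i)) =
      lower ω.form X.Q m (fun i => Φ ((LinearMap.id + (1 : k) • N : _ →ₗ[k] (T × Module.Dual k T)) (e i)))
    congr 1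
    funext i
    simp [hΦN]
  rw [h, h', hΦ'eq, compLinearMap_add_smul]
  refine Finset.sum_congr rfl fun r _ => ?_
  rw [hiter, one_pow, one_smul, smul_smul,
    inv_mul_cancel₀ (Nat.cast_ne_zero.2 r.factorial_ne_zero), one_smul]

end Gauge

/-! ### Naturality -/

section Naturality

variable {k : Type*} [Field k] {G : Type*} [AddCommGroup G] [Module k G] {𝒢 : Grading k G}
  {T : Type*} [AddCommGroup T] [Module k T] {𝒯 : Grading k T}
  {X : LInfinity 𝒢} {n : ℤ} {ω : ShiftedSymplectic X n} {L : LInfinity 𝒯} {f : T →ₗ[k] G}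
  {Φ : (T × Module.Dual k T) ≃ₗ[k] G} {P : FormalMap k (T × Module.Dual k T) k}
  {G' : Type*} [AddCommGroup G'] [Module k G'] {𝒢' : Grading k G'}
  {T' : Type*} [AddCommGroup T'] [Module k T'] {𝒯' : Grading k T'}
  {X' : LInfinity 𝒢'} {ω' : ShiftedSymplectic X' n} {L' : LInfinity 𝒯'} {f' : T' →ₗ[k] G'}
  {ψ : G ≃ₗ[k] G'} {χ : T ≃ₗ[k] T'}

theorem Grading.symm_mem (hχ : ∀ i, ∀ x ∈ 𝒯.deg i, χ x ∈ 𝒯'.deg i) (i : ℤ) (y : T')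
    (hy : y ∈ 𝒯'.deg i) : χ.symm y ∈ 𝒯.deg i :=
  Grading.mem_of_map_mem (f := χ.toLinearMap) hχ χ.injective (by simpa using hy)

theorem IsRegularLagrangian.transport (hf : IsRegularLagrangian ω L f)
    (hψ : IsStrictMap 𝒢 𝒢' X.Q X'.Q ψ.toLinearMap) (hχ : IsStrictMap 𝒯 𝒯' L.Q L'.Q χ.toLinearMap)
    (hω : ∀ x y, ω'.form (ψ x) (ψ y) = ω.form x y) (hff' : ∀ x, ψ (f x) = f' (χ x)) :
    IsRegularLagrangian ω' L' f' := by
  have hf' : ∀ y, f' y = ψ (f (χ.symm y)) := fun y => by rw [hff', χ.apply_symm_apply]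
  refine ⟨⟨fun i y hy => ?_, fun m v => ?_⟩, fun x y h => ?_, fun x y => ?_, fun y h => ?_⟩
  · rw [hf']
    exact hψ.map_deg _ _ (hf.strict.map_deg _ _ (Grading.symm_mem hχ.map_deg i y hy))
  · have h₁ := hχ.map_bracket m fun i => χ.symm (v i)
    simp only [LinearEquiv.coe_coe, LinearEquiv.apply_symm_apply] at h₁
    rw [← h₁, ← hff', hf.strict.map_bracket]
    have h₂ := hψ.map_bracket m fun i => f (χ.symm (v i))
    simp only [LinearEquiv.coe_coe, ← hf'] at h₂
    exact h₂
  · rw [hf', hf'] at h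
    exact χ.symm.injective (hf.injective (ψ.injective h))
  · rw [hf', hf', hω, hf.isotropic]
  · obtain ⟨x, hx⟩ := hf.coisotropic (ψ.symm y) fun x => by
      rw [← hω, ψ.apply_symm_apply, hff', h]
    exact ⟨χ x, by rw [← hff', hx, ψ.apply_symm_apply]⟩

variable [FiniteDimensional k T] [FiniteDimensional k T']

theorem IsSplitting.transport (hΦ : IsSplitting ω 𝒯 f Φ)
    (hψ : ∀ i, ∀ x ∈ 𝒢.deg i, ψ x ∈ 𝒢'.deg i) (hχ : ∀ i, ∀ x ∈ 𝒯.deg i, χ x ∈ 𝒯'.deg i)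
    (hω : ∀ x y, ω'.form (ψ x) (ψ y) = ω.form x y) (hff' : ∀ x, ψ (f x) = f' (χ x)) :
    IsSplitting ω' 𝒯' f' (((χ.prodCongr χ.dualMap.symm).symm.trans Φ).trans ψ) where
  map_deg i e he := by
    refine hψ i _ (hΦ.map_deg i _ ⟨Grading.symm_mem hχ i _ he.1, fun j hj x hx => ?_⟩)
    exact he.2 j hj _ (hχ j x hx)
  zero_section y := by
    change ψ (Φ (χ.symm y, χ.dualMap 0)) = f' y
    rw [map_zero, hΦ.zero_section, hff', χ.apply_symm_apply]
  symplectic e e' := by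
    change ω'.form (ψ (Φ (χ.symm e.1, χ.dualMap e.2))) (ψ (Φ (χ.symm e'.1, χ.dualMap e'.2))) = _
    -- The sign operator depends on degrees only, so it commutes with `χ`.
    have h := Grading.map_act (f := χ.toLinearMap) hχ
      (fun i => (((((n + 1) * i).negOnePow : ℤˣ) : ℤ) : k)) (χ.symm e.1)
    rw [hω, hΦ.symplectic]
    simp only [canonicalForm, LinearMap.mk₂_apply, LinearEquiv.dualMap_apply,
      LinearEquiv.apply_symm_apply]
    congr 2
    simpa [Grading.signOp] using h

theorem IsPolyvector.pushforward {d : ℤ} (hP : IsPolyvector 𝒯 n d P)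
    (hχ : ∀ i, ∀ x ∈ 𝒯.deg i, χ x ∈ 𝒯'.deg i) : IsPolyvector 𝒯' n d (pushforward χ P) := by
  have hΘ : ∀ i, ∀ e ∈ (𝒯'.cotangent n).deg i,
      χ.symm.toLinearMap.prodMap χ.dualMap.toLinearMap e ∈ (𝒯.cotangent n).deg i := fun i e he =>
    ⟨Grading.symm_mem hχ i _ he.1, fun j hj x hx => he.2 j hj _ (hχ j x hx)⟩
  refine ⟨hP.symm.pullback hΘ, hP.degree.pullback hΘ, fun m => ?_, fun m => ?_⟩
  · rw [FormalModuli.pushforward, weightPart_compLinearMap, hP.weight_zero]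
    rfl
  · rw [FormalModuli.pushforward, weightPart_compLinearMap, hP.weight_one]
    rfl

/-- As `ψ` respects both `Q` and the form, the new Hamiltonian is the old one in the coordinates
moved by `χ`. Taking fibre degree one commutes with this change of coordinates, so the remaining
part is `pushforward χ P`. -/
theorem IsInducedPoisson.transport (h : IsInducedPoisson ω L f Φ P)
    (hf : IsRegularLagrangian ω L f) (hψ : IsStrictMap 𝒢 𝒢' X.Q X'.Q ψ.toLinearMap)
    (hχ : IsStrictMap 𝒯 𝒯' L.Q L'.Q χ.toLinearMap)
    (hω : ∀ x y, ω'.form (ψ x) (ψ y) = ω.form x y) (hff' : ∀ x, ψ (f x) = f' (χ x)) :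
    IsInducedPoisson ω' L' f' (((χ.prodCongr χ.dualMap.symm).symm.trans Φ).trans ψ)
      (pushforward χ P) := by
  have hf' := hf.transport hψ hχ hω hff'
  have hΦ' := h.splitting.transport hψ.map_deg hχ.map_deg hω hff'
  refine hΦ'.isInducedPoisson hf' (h.poisson.polyvector.pushforward hχ.map_deg) (funext fun m => ?_)
  have hH : splitHamiltonian ω' (((χ.prodCongr χ.dualMap.symm).symm.trans Φ).trans ψ) m =
      (splitHamiltonian ω Φ m).compLinearMap fun _ =>
        χ.symm.toLinearMap.prodMap χ.dualMap.toLinearMap := by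
    cases m with
    | zero => rfl
    | succ m =>
      ext e
      rw [MultilinearMap.compLinearMap_apply, splitHamiltonian_apply, splitHamiltonian_apply, ← hω]
      exact congrArg (fun z => ω'.form z _) (hψ.map_bracket m _).symm
  rw [totalHamiltonian, hΦ'.linearFunction_eq hf', hH, weightPart_compLinearMap,
    ← h.splitting.linearFunction_eq hf, ← h.totalHamiltonian_eq hf]
  rfl

end Naturality

end

end FormalModuli

/-! ### Assembly of the proposition. -/

theorem mainTheorem3 {k : Type*} [Field k] [CharZero k] (n : ℤ)
    {G : Type u} [AddCommGroup G] [Module k G] [FiniteDimensional k G] {𝒢 : Grading k G}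
    {T : Type v} [AddCommGroup T] [Module k T] [FiniteDimensional k T] {𝒯 : Grading k T}
    (X : LInfinity 𝒢) (ω : ShiftedSymplectic X n) (L : LInfinity 𝒯) (f : T →ₗ[k] G)
    (hf : IsRegularLagrangian ω L f) :
    -- the normal bundle of `L` in `X` is `T^*[n]L`: the map `f^* T_X → L_L[n]`, `w ↦ ω (w, f -)`,
    -- is a surjective map of vector bundles on `L` whose kernel is `T_L`
    ((∀ ξ : Module.Dual k T, ∃ w : G, ω.form w ∘ₗ f = ξ) ∧
      (∀ w : G, ω.form w ∘ₗ f = 0 ↔ w ∈ LinearMap.range f) ∧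
      ∀ (m : ℕ) (v : Fin m → T) (w : Fin m → G),
        twistedCotangent L n 0 m (fun i => (v i, ω.form (w i) ∘ₗ f)) =
          (L.Q m v, ω.form (∑ i, X.Q m (Function.update (fun j => f (v j)) i (w i))) ∘ₗ f)) ∧
    -- isotropic complements exist, and each of them determines a symplectic splitting
    (∃ M, IsIsotropicComplement ω f M) ∧
    (∀ M, IsIsotropicComplement ω f M →
      ∃! Φ : (T × Module.Dual k T) ≃ₗ[k] G, IsSplitting ω 𝒯 f Φ ∧ ∀ ξ, Φ (0, ξ) ∈ M) ∧
    -- each splitting determines a homotopy Poisson structure on `L`, unique with `T^*_P[n]L ≅ X`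
    (∀ Φ, IsSplitting ω 𝒯 f Φ → ∃ P, IsInducedPoisson ω L f Φ P ∧
      ∀ P', IsPolyvector 𝒯 n (n + 1) P' →
        IsStrictMap (𝒯.cotangent n) 𝒢 (twistedCotangent L n P') X.Q Φ.toLinearMap → P' = P) ∧
    -- it is the deformation to the normal cone: a family over the affine line with fibre
    -- `T^*[n]L` at `0` and with all other fibres isomorphic to `X` by dilating the normal directions
    (∀ Φ P, IsInducedPoisson ω L f Φ P →
      (∀ c : k, IsHomotopyPoisson L n (rescale c P)) ∧ rescale 0 P = 0 ∧ rescale 1 P = P ∧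
      ∀ c : k, c ≠ 0 → IsStrictMap (𝒯.cotangent n) 𝒢 (twistedCotangent L n (rescale c P)) X.Q
        (Φ.toLinearMap ∘ₗ dilation k T c)) ∧
    -- it does not depend on the splitting up to gauge equivalence
    (∀ Φ P Φ' P', IsInducedPoisson ω L f Φ P → IsInducedPoisson ω L f Φ' P' →
      GaugeEquivalent L n P P') ∧
    -- it is natural with respect to isomorphisms of embedded Lagrangians
    (∀ {G' : Type u} [AddCommGroup G'] [Module k G'] [FiniteDimensional k G'] {𝒢' : Grading k G'}
      {T' : Type v} [AddCommGroup T'] [Module k T'] [FiniteDimensional k T'] {𝒯' : Grading k T'}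
      (X' : LInfinity 𝒢') (ω' : ShiftedSymplectic X' n) (L' : LInfinity 𝒯') (f' : T' →ₗ[k] G')
      (ψ : G ≃ₗ[k] G') (χ : T ≃ₗ[k] T'),
      IsStrictMap 𝒢 𝒢' X.Q X'.Q ψ.toLinearMap → IsStrictMap 𝒯 𝒯' L.Q L'.Q χ.toLinearMap →
      (∀ x y, ω'.form (ψ x) (ψ y) = ω.form x y) → (∀ x, ψ (f x) = f' (χ x)) →
      ∀ Φ P, IsInducedPoisson ω L f Φ P →
        IsInducedPoisson ω' L' f'
          (((χ.prodCongr χ.dualMap.symm).symm.trans Φ).trans ψ) (pushforward χ P)) := by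
  -- The normal bundle formula does not mention a splitting, but any one of them gives coordinates
  -- in which to verify it.
  have hf' : ∃ Φ, IsSplitting ω 𝒯 f Φ :=
    hf.exists_isotropicSection.elim fun σ hσ => (hf.exists_splitting hσ).imp fun _ h => h.1
  refine ⟨⟨fun ξ => hf.restrictForm_surjective ξ, hf.restrictForm_eq_zero, fun m v w => ?_⟩,
    ?_, fun M hM => hf.existsUnique_splitting hM, fun Φ hΦ => ?_, fun Φ P h => ?_, ?_, ?_⟩
  · obtain ⟨Φ, hΦ⟩ := hf'
    exact hΦ.twistedCotangent_zero_apply hf v w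
  · obtain ⟨σ, hσ⟩ := hf.exists_isotropicSection
    exact ⟨_, hf.isIsotropicComplement_range hσ⟩
  · refine ⟨splitPoisson ω Φ, hΦ.isInducedPoisson hf (hΦ.isPolyvector_splitPoisson hf)
      (hΦ.totalHamiltonian_splitPoisson hf), fun P' hP' h => ?_⟩
    exact totalHamiltonian_injective (((hΦ.strict_twistedCotangent_iff hf hP').1 h).trans
      (hΦ.totalHamiltonian_splitPoisson hf).symm)
  · exact ⟨h.isHomotopyPoisson_rescale hf, h.poisson.polyvector.rescale_zero, rescale_one P,
      fun c hc => (h.rescale hf c hc).strict⟩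
  · intro Φ P Φ' P' h h'
    exact h.splitting.gaugeEquivalent h'.splitting hf (h.totalHamiltonian_eq hf)
      (h'.totalHamiltonian_eq hf)
  · intro G' _ _ _ 𝒢' T' _ _ _ 𝒯' X' ω' L' f' ψ χ hψ hχ hω hff' Φ P h
    exact h.transport hf hψ hχ hω hff'
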